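/- For a permutation $\sigma$ of $\{1,\dots,n\}$, let $P(\sigma)$ be the insertion tableau obtained by inserting $\sigma(1),\sigma(2),\dots,\sigma(n)$ in this order, by Robinson--Schensted--Knuth row insertion, into the empty tableau, and call the partition of $n$ formed by the row lengths of $P(\sigma)$ the RSK shape of $\sigma$. The cycle decomposition of $\sigma$ is the partition of $n$ formed by the lengths of all its cycles, including a part $1$ for every fixed point. A cycle decomposition $c$ (a partition of $n$) is called RSK-complete if every partition of $n$ other than $(n)$ and $(1,1,\dots,1)$ is the RSK shape of at least one permutation with cycle decomposition $c$. Theorem. Let $n \geq 1$ be an integer with $n \neq 2$. If $n$ is even, then the cycle decomposition $(n)$ is RSK-complete, and no other cycle decomposition is. If $n$ is odd, then the cycle decompositions $(n)$ and (for $n \geq 3$) $(n-1,1)$ are RSK-complete, and no other cycle decomposition is. -/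

import Mathlib

/-- Row insertion of `a` into a (strictly increasing) row: the leftmost entry greater than `a`
is replaced by `a` and returned as the displaced element; if there is none, `a` is put at the
end of the row and nothing is displaced. -/
def rowInsert (a : ℕ) : List ℕ → List ℕ × Option ℕ
  | [] => ([a], none)
  | b :: r => if a < b then (a :: r, some b) else (b :: (rowInsert a r).1, (rowInsert a r).2)

/-- Insertion of `a` into a tableau (given as its list of rows, top row first): insert `a` into
the first row and insert the displaced element, if any, into the tableau formed by the remaining
rows. Displacing an element from the last row starts a new row. -/
def tableauInsert (a : ℕ) : List (List ℕ) → List (List ℕ)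
  | [] => [[a]]
  | r :: T =>
    match rowInsert a r with
    | (r', none) => r' :: T
    | (r', some b) => r' :: tableauInsert b T

/-- The insertion tableau `P(σ)` of a sequence `σ`, obtained by inserting the entries of `σ`
from left to right, starting with the empty tableau. -/
def insertionTableau (σ : List ℕ) : List (List ℕ) :=
  σ.foldl (fun T a => tableauInsert a T) []

/-- The shape of a tableau: its row lengths, as a multiset (that is, up to sorting). -/
def tableauShape (T : List (List ℕ)) : Multiset ℕ :=
  (T.map List.length : List ℕ)

/-- The one-line notation `(σ 1, …, σ n)` of a permutation of `{1, …, n}`; the element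
`i : Fin n` stands for the integer `i + 1`. -/
def oneLine {n : ℕ} (σ : Equiv.Perm (Fin n)) : List ℕ :=
  List.ofFn fun i => (σ i : ℕ) + 1

/-- The RSK shape of a permutation. -/
def rskShape {n : ℕ} (σ : Equiv.Perm (Fin n)) : Multiset ℕ :=
  tableauShape (insertionTableau (oneLine σ))

/-- A set of permutations is RSK-complete if every partition of `n` other than `(n)` and
`(1, …, 1)` is the RSK shape of one of its elements. -/
def IsRSKComplete {n : ℕ} (S : Set (Equiv.Perm (Fin n))) : Prop :=
  ∀ μ : n.Partition, μ.parts ≠ {n} → μ.parts ≠ Multiset.replicate n 1 →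
    ∃ σ ∈ S, rskShape σ = μ.parts

/-- The set of all permutations with cycle decomposition `c`; the parts of
`Equiv.Perm.partition` are the lengths of all cycles, fixed points included. -/
def permsWithCycleDecomposition {n : ℕ} (c : n.Partition) : Set (Equiv.Perm (Fin n)) :=
  {σ | σ.partition.parts = c.parts}

/-- A cycle decomposition is RSK-complete if the set of all permutations having it is. -/
def IsRSKCompleteCycleDecomposition {n : ℕ} (c : n.Partition) : Prop :=
  IsRSKComplete (permsWithCycleDecomposition c)

/-! Necessity rests on two shapes. A permutation of shape (n-1, 1) is increasing after deletion of
one letter, so it moves one letter past an interval of others and is a single cycle together with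
fixed points (`isCycle_of_rskShape_eq`). For a two-row shape the letters bumped from the first row
form an increasing sequence. Then a letter that bumps is never bumped, and a fixed point does
neither, so twice the number of bumped letters plus the number of fixed points is at most n
(`two_mul_length_bumped_add_card_le`). For the shape (⌈n/2⌉, ⌊n/2⌋) at most n mod 2 fixed points
remain. A cycle type admitting both shapes is (n), or (n-1, 1) with n odd.

Sufficiency builds a permutation of given shape column by column. From a cycle σ on {0, …, n-1} and
a new column height k, multiplication by `zigzag` replaces one value t of the one-line notation by
n+m-1 and appends t and the other new values in decreasing order. A decreasing run adds a column to
the tableau if it fits (`insertionTableau_append_reverse`), and if t is the largest old value, the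
replacement only relabels the old tableau. In the cycle, the arrow into t becomes a detour through
the new positions that alternates between two reflections and spirals outwards from the middle. For
m close to k/2 it visits every new position except possibly the centre of one reflection
(`CyclicOutside.zigzag_mul`). The invariant `Extendable` guarantees that the next column fits.

The first two columns are built together (`extendable_twoCol`), because the only permutation with a
one-column tableau is the reversal. For odd n, a fixed point can be left over at the last column of
odd height, with adjustments in the first two columns and for columns of height one. -/

/-! ### Row insertion and relabelling -/

theorem rowInsert_of_forall_lt {a : ℕ} {r : List ℕ} (h : ∀ x ∈ r, x < a) :
    rowInsert a r = (r ++ [a], none) := by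
  induction r with
  | nil => rfl
  | cons b r ih =>
    have hb : ¬ a < b := by have := h b (by simp); omega
    have ih := ih fun x hx => h x (by simp [hx])
    simp [rowInsert, hb, ih]

theorem rowInsert_append_singleton {a b : ℕ} {r : List ℕ} (h : ∀ x ∈ r, x < a) (hab : a < b) :
    rowInsert a (r ++ [b]) = (r ++ [a], some b) := by
  induction r with
  | nil => simp [rowInsert, hab]
  | cons u r ih =>
    have hb : ¬ a < u := by have := h u (by simp); omega
    have ih := ih fun x hx => h x (by simp [hx])
    simp [rowInsert, hb, ih]

theorem rowInsert_map {g : ℕ → ℕ} (hg : StrictMono g) (a : ℕ) (r : List ℕ) :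
    rowInsert (g a) (r.map g) = ((rowInsert a r).1.map g, (rowInsert a r).2.map g) := by
  induction r with
  | nil => rfl
  | cons b r ih =>
    by_cases h : a < b
    · simp [rowInsert, h, hg h]
    · simp [rowInsert, h, hg.lt_iff_lt, ih]

theorem tableauInsert_map {g : ℕ → ℕ} (hg : StrictMono g) (a : ℕ) (T : List (List ℕ)) :
    tableauInsert (g a) (T.map (List.map g)) = (tableauInsert a T).map (List.map g) := by
  induction T generalizing a with
  | nil => rfl
  | cons r T ih =>
    rw [List.map_cons, tableauInsert, tableauInsert, rowInsert_map hg]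
    rcases rowInsert a r with ⟨r', _ | b⟩
    · rfl
    · simp [ih]

/-- Relabelling the letters of a word by a strictly increasing map relabels its insertion
tableau. -/
theorem insertionTableau_map {g : ℕ → ℕ} (hg : StrictMono g) (w : List ℕ) :
    insertionTableau (w.map g) = (insertionTableau w).map (List.map g) := by
  induction w using List.reverseRecOn with
  | nil => rfl
  | append_singleton w a ih =>
    simp only [insertionTableau, List.map_append, List.map_cons, List.map_nil, List.foldl_append,
      List.foldl_cons, List.foldl_nil] at ih ⊢
    rw [ih, tableauInsert_map hg]

theorem mem_or_of_mem_rowInsert {a x : ℕ} {r : List ℕ} (h : x ∈ (rowInsert a r).1) :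
    x ∈ r ∨ x = a := by
  induction r with
  | nil => simpa [rowInsert] using h
  | cons b r ih =>
    by_cases hab : a < b
    · simp [rowInsert, hab] at h
      grind
    · simp [rowInsert, hab] at h
      grind

theorem mem_of_rowInsert_eq_some {a b : ℕ} {r : List ℕ} (h : (rowInsert a r).2 = some b) :
    b ∈ r := by
  induction r with
  | nil => simp [rowInsert] at h
  | cons u r ih =>
    by_cases hab : a < u
    · simp [rowInsert, hab] at h
      simp [h]
    · simp [rowInsert, hab] at h
      simp [ih h]

theorem mem_or_of_mem_tableauInsert {a x : ℕ} {T : List (List ℕ)}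
    (h : x ∈ (tableauInsert a T).flatten) : x ∈ T.flatten ∨ x = a := by
  induction T generalizing a with
  | nil => simpa [tableauInsert] using h
  | cons r T ih =>
    rw [tableauInsert] at h
    have h1 := @mem_or_of_mem_rowInsert a x r
    have h2 := fun b => @mem_of_rowInsert_eq_some a b r
    rcases hr : rowInsert a r with ⟨r', _ | b⟩
    · simp only [hr, List.flatten_cons, List.mem_append] at h h1 ⊢
      tauto
    · simp only [hr, List.flatten_cons, List.mem_append] at h h1 h2 ⊢
      rcases h with h | h
      · tauto
      · rcases ih h with h | rfl
        · tauto
        · exact Or.inl (Or.inl (h2 _ rfl))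

theorem mem_of_mem_insertionTableau {x : ℕ} {w : List ℕ}
    (h : x ∈ (insertionTableau w).flatten) : x ∈ w := by
  induction w using List.reverseRecOn with
  | nil => simp [insertionTableau] at h
  | append_singleton w a ih =>
    simp only [insertionTableau, List.foldl_append, List.foldl_cons, List.foldl_nil] at ih h
    rcases mem_or_of_mem_tableauInsert h with h | rfl
    · exact List.mem_append_left _ (ih h)
    · simp

/-! ### Appending columns to tableaux and shapes -/

/-- `appendCol T u` appends the entries of `u`, from the top down, to the rows of `T`. -/
def appendCol : List (List ℕ) → List ℕ → List (List ℕ)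
  | T, [] => T
  | [], a :: u => [a] :: appendCol [] u
  | r :: T, a :: u => (r ++ [a]) :: appendCol T u

@[simp]
theorem appendCol_nil (T : List (List ℕ)) : appendCol T [] = T := by
  cases T <;> rfl

/-- The column `u` can be appended to `T`: its entries are greater than all those in the
corresponding rows. -/
def FitsCol (T : List (List ℕ)) (u : List ℕ) : Prop :=
  ∀ i, ∀ x ∈ T.getD i [], ∀ a ∈ u[i]?, x < a

theorem FitsCol.tail {r u : List ℕ} {T : List (List ℕ)} {a : ℕ}
    (h : FitsCol (r :: T) (a :: u)) : FitsCol T u :=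
  fun i => h (i + 1)

theorem fitsCol_nil_left (u : List ℕ) : FitsCol [] u := by
  intro i x hx
  simp at hx

/-- The letter `a` exceeds the first row of `T` but not the head of `u` at the end of that row, so
it bumps this head. The same happens in each later row: the column slides down by one and `a`
becomes its top. -/
theorem tableauInsert_appendCol {a : ℕ} {u : List ℕ} {T : List (List ℕ)}
    (hc : (a :: u).Pairwise (· < ·)) (h : FitsCol T (a :: u)) :
    tableauInsert a (appendCol T u) = appendCol T (a :: u) := by
  induction u generalizing a T with
  | nil =>
    cases T with
    | nil => rfl
    | cons r T =>
      have hr : ∀ x ∈ r, x < a := fun x hx => h 0 x (by simpa using hx) a (by simp)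
      simp [tableauInsert, appendCol, rowInsert_of_forall_lt hr]
  | cons b u ih =>
    have hab : a < b := (List.pairwise_cons.1 hc).1 b (by simp)
    cases T with
    | nil =>
      have := ih (List.pairwise_cons.1 hc).2 (fitsCol_nil_left _)
      simp [tableauInsert, appendCol, rowInsert, hab, this]
    | cons r T =>
      have hr : ∀ x ∈ r, x < a := fun x hx => h 0 x (by simpa using hx) a (by simp)
      have := ih (List.pairwise_cons.1 hc).2 h.tail
      simp [tableauInsert, appendCol, rowInsert_append_singleton hr hab, this]

theorem FitsCol.of_cons {a : ℕ} {u : List ℕ} {T : List (List ℕ)}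
    (hc : (a :: u).Pairwise (· < ·)) (h : FitsCol T (a :: u)) : FitsCol T u := by
  intro i x hx b hb
  have hi : i < (a :: u).length := by
    have := (List.getElem?_eq_some_iff.1 hb).1
    simp
    omega
  have h1 := h i x hx (a :: u)[i] (by simp)
  have h2 : (a :: u)[i] < b := by
    obtain ⟨hi', rfl⟩ := List.getElem?_eq_some_iff.1 hb
    have := List.pairwise_iff_getElem.1 hc i (i + 1) hi (by simpa using hi') (by omega)
    simpa using this
  omega

/-- Inserting a column from the bottom up appends it to the tableau. -/
theorem foldl_tableauInsert_reverse {u : List ℕ} {T : List (List ℕ)}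
    (hc : u.Pairwise (· < ·)) (h : FitsCol T u) :
    u.reverse.foldl (fun T a => tableauInsert a T) T = appendCol T u := by
  induction u with
  | nil => simp
  | cons a u ih =>
    rw [List.reverse_cons, List.foldl_append, ih (List.pairwise_cons.1 hc).2 (h.of_cons hc)]
    exact tableauInsert_appendCol hc h

theorem insertionTableau_append_reverse {u w : List ℕ} (hc : u.Pairwise (· < ·))
    (h : FitsCol (insertionTableau w) u) :
    insertionTableau (w ++ u.reverse) = appendCol (insertionTableau w) u := by
  rw [insertionTableau, List.foldl_append]
  exact foldl_tableauInsert_reverse hc h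

theorem mem_getD_appendCol {i x : ℕ} {u : List ℕ} {T : List (List ℕ)}
    (h : x ∈ (appendCol T u).getD i []) : x ∈ T.getD i [] ∨ u[i]? = some x := by
  induction u generalizing T i with
  | nil => left; simpa using h
  | cons a u ih =>
    cases T with
    | nil =>
      cases i with
      | zero => simp [appendCol] at h; simp [h]
      | succ i => exact ih (T := []) (by simpa [appendCol] using h)
    | cons r T =>
      cases i with
      | zero =>
        simp [appendCol] at h
        rcases h with h | h <;> simp [h]
      | succ i => exact ih (T := T) (by simpa [appendCol] using h)

/-- Add a column of height `k` to a shape. -/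
def addCol : List ℕ → ℕ → List ℕ
  | l, 0 => l
  | [], k + 1 => 1 :: addCol [] k
  | a :: l, k + 1 => (a + 1) :: addCol l k

@[simp]
theorem addCol_zero (l : List ℕ) : addCol l 0 = l := by
  cases l <;> rfl

theorem map_length_appendCol (T : List (List ℕ)) (u : List ℕ) :
    (appendCol T u).map List.length = addCol (T.map List.length) u.length := by
  induction u generalizing T with
  | nil => simp
  | cons a u ih =>
    cases T with
    | nil => simpa [appendCol, addCol] using ih []
    | cons r T => simpa [appendCol, addCol] using ih T

/-- `L.map (min j)` consists of the first `j` columns of the shape `L`, and the count is the height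
of the next one. Sortedness puts the rows that meet this column on top. -/
theorem addCol_map_min {L : List ℕ} (hL : L.Pairwise (· ≥ ·)) (j : ℕ) :
    addCol (L.map (min j)) (L.countP (j < ·)) = L.map (min (j + 1)) := by
  induction L with
  | nil => rfl
  | cons a L ih =>
    rw [List.pairwise_cons] at hL
    by_cases h : j < a
    · rw [List.countP_cons_of_pos (by simpa using h), List.map_cons, addCol, ih hL.2, List.map_cons]
      congr 1
      omega
    · have h0 : (a :: L).countP (j < ·) = 0 := by
        rw [List.countP_eq_zero]
        intro x hx
        rcases List.mem_cons.1 hx with rfl | hx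
        · simpa using h
        · have := hL.1 x hx
          simp
          omega
      rw [h0, addCol_zero]
      apply List.map_congr_left
      intro x hx
      have := List.countP_eq_zero.1 h0 x hx
      simp at this
      omega

theorem addCol_nil (k : ℕ) : addCol [] k = List.replicate k 1 := by
  induction k with
  | zero => rfl
  | succ k ih => rw [addCol, ih, List.replicate_succ]

/-! ### The zigzag permutation and its effect on cycles -/

/-- The permutation of `{t} ∪ {n, …, n + k - 1}` whose one-line notation on `n, …, n + k - 1` is
the decreasing sequence of `t, n, …, n + k - 1` with `n + m - 1` left out, and which
sends `t` to `n + m - 1`. All other numbers are fixed. -/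
def zigzag (n k m t : ℕ) (hm : 0 < m) (hmk : m ≤ k) (ht : t < n) : Equiv.Perm ℕ where
  toFun x :=
    if x = t then n + m - 1
    else if x < n ∨ n + k ≤ x then x
    else if x + m < n + k then 2 * n + k - 1 - x
    else if x + 1 = n + k then t
    else 2 * n + k - 2 - x
  invFun y :=
    if y = t then n + k - 1
    else if y < n ∨ n + k ≤ y then y
    else if y + 1 = n + m then t
    else if n + m ≤ y then 2 * n + k - 1 - y
    else 2 * n + k - 2 - y
  left_inv x := by
    dsimp only
    split_ifs <;> omega
  right_inv y := by
    dsimp only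
    split_ifs <;> omega

section zigzag

variable {n k m t : ℕ} (hm : 0 < m) (hmk : m ≤ k) (ht : t < n)

theorem zigzag_self : zigzag n k m t hm hmk ht t = n + m - 1 := by
  simp [zigzag]

theorem zigzag_of_lt {x : ℕ} (hx : x < n) (hxt : x ≠ t) : zigzag n k m t hm hmk ht x = x := by
  simp [zigzag, hx, hxt]

theorem zigzag_of_ge {x : ℕ} (hx : n + k ≤ x) : zigzag n k m t hm hmk ht x = x := by
  have : x ≠ t := by omega
  simp [zigzag, hx, this]

theorem zigzag_add {i : ℕ} (hi : i < k) : zigzag n k m t hm hmk ht (n + i) =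
    if i + m < k then n + (k - 1 - i) else if i + 1 = k then t else n + (k - 2 - i) := by
  simp only [zigzag, Equiv.coe_fn_mk]
  split_ifs <;> omega

/-- On offsets, the map is the reflection `i ↦ k - 1 - i` below `k - m` and `i ↦ k - 2 - i` from
there on, except that the last offset goes to `t`. A fixed offset is the centre of a reflection
lying in its own range. -/
theorem zigzag_eq_self_iff {i : ℕ} (hi : i < k) : zigzag n k m t hm hmk ht (n + i) = n + i ↔
    (i < k - m ∧ 2 * i + 1 = k) ∨ (k - m ≤ i ∧ 2 * i + 2 = k ∧ i + 1 ≠ k) := by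
  rw [zigzag_add hm hmk ht hi]
  split_ifs <;> omega

end zigzag

/-- `σ` permutes `{0, …, n - 1}` with fixed points the elements of `F` and at most one
further cycle there, and fixes all `x ≥ n`. -/
structure CyclicOutside (σ : Equiv.Perm ℕ) (n : ℕ) (F : Set ℕ) : Prop where
  apply_of_ge : ∀ x, n ≤ x → σ x = x
  sameCycle : ∀ x y, x < n → y < n → x ∉ F → y ∉ F → σ.SameCycle x y
  lt_of_mem : ∀ x ∈ F, x < n
  apply_of_mem : ∀ x ∈ F, σ x = x

theorem CyclicOutside.apply_lt {σ : Equiv.Perm ℕ} {n : ℕ} {F : Set ℕ} (h : CyclicOutside σ n F)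
    {x : ℕ} (hx : x < n) : σ x < n := by
  by_contra hn
  have := h.apply_of_ge (σ x) (by omega)
  have := σ.injective this
  omega

theorem CyclicOutside.zpow_apply_lt {σ : Equiv.Perm ℕ} {n : ℕ} {F : Set ℕ}
    (h : CyclicOutside σ n F) (i : ℤ) {x : ℕ} (hx : x < n) : (σ ^ i) x < n := by
  by_contra hn
  have h1 : (σ ^ (-i)) ((σ ^ i) x) = (σ ^ i) x :=
    Equiv.Perm.zpow_apply_eq_self_of_apply_eq_self (h.apply_of_ge _ (by omega)) _
  rw [← Equiv.Perm.mul_apply, ← zpow_add] at h1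
  simp at h1
  omega

/-- The arrow of `σ` into `t` now goes to `n + m - 1`, and the new positions lead back to `t`. The
old cycle is thus kept, with a detour inserted. The bounds on `m` ensure that every new position
that is not fixed lies on this detour. -/
theorem CyclicOutside.zigzag_mul {σ : Equiv.Perm ℕ} {n k m t : ℕ} {F : Set ℕ}
    (h : CyclicOutside σ n F) (hm : 0 < m) (hmk : m ≤ k) (ht : t < n) (htF : t ∉ F)
    (h1 : 2 * m ≤ k + 2) (h2 : k ≤ 2 * m + 1) :
    CyclicOutside (zigzag n k m t hm hmk ht * σ) (n + k)
      (F ∪ {x | n ≤ x ∧ x < n + k ∧ zigzag n k m t hm hmk ht x = x}) := by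
  set ρ := zigzag n k m t hm hmk ht with hρ
  have hadd : ∀ i, (ρ * σ) (n + i) = ρ (n + i) := by
    intro i
    rw [Equiv.Perm.mul_apply, h.apply_of_ge _ (by omega)]
  have step : ∀ x y, (ρ * σ) x = y → (ρ * σ).SameCycle y t → (ρ * σ).SameCycle x t := by
    rintro x y rfl hy
    exact Equiv.Perm.sameCycle_apply_left.1 hy
  -- Two reflections in succession lower the offset by one: `i ↦ k - 1 - i ↦ i - 1`. From offset 0
  -- the path is `0 ↦ k - 1`, and then it exits to `t`.
  have low : ∀ i, i < k → i < m → i + m < k → 2 * i + 1 ≠ k → (ρ * σ).SameCycle (n + i) t := by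
    intro i
    induction i with
    | zero =>
      intro hk _ hmk' hi
      refine step _ (n + (k - 1 - 0)) ?_ (step _ t ?_ (Equiv.Perm.SameCycle.refl _ _))
      · rw [hadd, hρ, zigzag_add hm hmk ht hk, if_pos hmk']
      · rw [hadd, hρ, zigzag_add hm hmk ht (by omega), if_neg (by omega), if_pos (by omega)]
    | succ i ih =>
      intro hk him hmk' hi
      refine step _ (n + (k - 1 - (i + 1))) ?_ (step _ (n + i) ?_ (ih (by omega) (by omega)
        (by omega) (by omega)))
      · rw [hadd, hρ, zigzag_add hm hmk ht hk, if_pos hmk']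
      · rw [hadd, hρ, zigzag_add hm hmk ht (by omega), if_neg (by omega), if_neg (by omega)]
        omega
  have new : ∀ i, i < k → ρ (n + i) ≠ n + i → (ρ * σ).SameCycle (n + i) t := by
    intro i hi hne
    rw [hρ, Ne, zigzag_eq_self_iff hm hmk ht hi] at hne
    by_cases him : i + m < k
    · exact low i hi (by omega) him (by omega)
    · by_cases hik : i + 1 = k
      · refine step _ t ?_ (Equiv.Perm.SameCycle.refl _ _)
        rw [hadd, hρ, zigzag_add hm hmk ht hi, if_neg him, if_pos hik]
      · refine step _ (n + (k - 2 - i)) ?_ (low _ (by omega) (by omega) (by omega) (by omega))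
        rw [hadd, hρ, zigzag_add hm hmk ht hi, if_neg him, if_neg hik]
  -- The entry point of the detour is never the centre of the reflection that acts on it.
  have hcentre : (ρ * σ).SameCycle (n + (m - 1)) t := by
    apply new _ (by omega)
    rw [hρ, Ne, zigzag_eq_self_iff hm hmk ht (by omega)]
    omega
  have old1 : ∀ x < n, (ρ * σ).SameCycle x (σ x) := by
    intro x hx
    have hσx := h.apply_lt hx
    by_cases hxt : σ x = t
    · rw [hxt]
      refine step _ (n + (m - 1)) ?_ hcentre
      rw [Equiv.Perm.mul_apply, hxt, hρ, zigzag_self]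
      omega
    · have h3 : (ρ * σ) x = σ x := by
        rw [Equiv.Perm.mul_apply, hρ, zigzag_of_lt hm hmk ht hσx hxt]
      rw [← h3]
      exact Equiv.Perm.sameCycle_apply_right.2 (Equiv.Perm.SameCycle.refl _ _)
  have old : ∀ x < n, ∀ i : ℤ, (ρ * σ).SameCycle x ((σ ^ i) x) := by
    intro x hx i
    induction i using Int.induction_on with
    | zero => exact Equiv.Perm.SameCycle.refl _ _
    | succ i ih =>
      have h3 : (σ ^ ((i : ℤ) + 1)) x = σ ((σ ^ (i : ℤ)) x) := by
        rw [add_comm, zpow_add, zpow_one, Equiv.Perm.mul_apply]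
      rw [h3]
      exact ih.trans (old1 _ (h.zpow_apply_lt _ hx))
    | pred i ih =>
      have h3 : σ ((σ ^ (-(i : ℤ) - 1)) x) = (σ ^ (-(i : ℤ))) x := by
        rw [← Equiv.Perm.mul_apply, ← zpow_one_add]
        congr 2
        ring
      refine ih.trans (Equiv.Perm.SameCycle.symm ?_)
      rw [← h3]
      exact old1 _ (h.zpow_apply_lt _ hx)
  have all : ∀ x, x < n + k →
      x ∉ F ∪ {x | n ≤ x ∧ x < n + k ∧ ρ x = x} → (ρ * σ).SameCycle x t := by
    intro x hx hxF
    rw [Set.mem_union, not_or] at hxF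
    by_cases hxn : x < n
    · obtain ⟨i, hi⟩ := h.sameCycle x t hxn ht hxF.1 htF
      rw [← hi]
      exact old x hxn i
    · obtain ⟨i, rfl⟩ := Nat.exists_eq_add_of_le (not_lt.1 hxn)
      apply new i (by omega)
      intro hi
      exact hxF.2 ⟨by omega, hx, hi⟩
  refine ⟨fun x hx => ?_, fun x y hx hy hxF hyF => (all x hx hxF).trans (all y hy hyF).symm,
    ?_, ?_⟩
  · rw [Equiv.Perm.mul_apply, h.apply_of_ge _ (by omega), hρ, zigzag_of_ge hm hmk ht hx]
  · rintro x (hx | hx)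
    · have := h.lt_of_mem x hx
      omega
    · exact hx.2.1
  · rintro x (hx | hx)
    · rw [Equiv.Perm.mul_apply, h.apply_of_mem x hx, hρ,
        zigzag_of_lt hm hmk ht (h.lt_of_mem x hx)]
      rintro rfl
      exact htF hx
    · rw [Equiv.Perm.mul_apply, h.apply_of_ge _ hx.1]
      exact hx.2.2

/-- If `m` is half of `k`, rounded up or down to suit, neither reflection has its centre in its
range. Moving `m` slightly off this value, as in the next two lemmas, produces exactly one fixed
point. -/
theorem setOf_zigzag_eq_empty {n k m t : ℕ} (hm : 0 < m) (hmk : m ≤ k) (ht : t < n)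
    (h : k = 2 * m ∨ k + 1 = 2 * m) :
    {x | n ≤ x ∧ x < n + k ∧ zigzag n k m t hm hmk ht x = x} = ∅ := by
  ext x
  simp only [Set.mem_ofPred_eq, Set.mem_empty_iff_false, iff_false]
  rintro ⟨hx, hxk, hx'⟩
  obtain ⟨i, rfl⟩ := Nat.exists_eq_add_of_le hx
  rw [zigzag_eq_self_iff hm hmk ht (by omega)] at hx'
  omega

theorem setOf_zigzag_eq_singleton {n k m t : ℕ} (hm : 0 < m) (hmk : m ≤ k) (ht : t < n)
    (h : k = 2 * m + 1) :
    {x | n ≤ x ∧ x < n + k ∧ zigzag n k m t hm hmk ht x = x} = {n + m} := by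
  ext x
  simp only [Set.mem_ofPred_eq, Set.mem_singleton_iff]
  constructor
  · rintro ⟨hx, hxk, hx'⟩
    obtain ⟨i, rfl⟩ := Nat.exists_eq_add_of_le hx
    rw [zigzag_eq_self_iff hm hmk ht (by omega)] at hx'
    omega
  · rintro rfl
    refine ⟨by omega, by omega, ?_⟩
    rw [zigzag_eq_self_iff hm hmk ht (by omega)]
    omega

theorem setOf_zigzag_eq_singleton' {n k m t : ℕ} (hm : 0 < m) (hmk : m ≤ k) (ht : t < n)
    (h : k + 2 = 2 * m) :
    {x | n ≤ x ∧ x < n + k ∧ zigzag n k m t hm hmk ht x = x} = {n + (m - 2)} := by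
  ext x
  simp only [Set.mem_ofPred_eq, Set.mem_singleton_iff]
  constructor
  · rintro ⟨hx, hxk, hx'⟩
    obtain ⟨i, rfl⟩ := Nat.exists_eq_add_of_le hx
    rw [zigzag_eq_self_iff hm hmk ht (by omega)] at hx'
    omega
  · rintro rfl
    refine ⟨by omega, by omega, ?_⟩
    rw [zigzag_eq_self_iff hm hmk ht (by omega)]
    omega

/-! ### One-line notation and tableaux under zigzag extension -/

/-- The one-line notation of the restriction of `σ` to `{0, …, n - 1}`, shifted by one. -/
def word (σ : Equiv.Perm ℕ) (n : ℕ) : List ℕ :=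
  (List.range n).map fun i => σ i + 1

/-- The column added to the insertion tableau on multiplication by `zigzag n k m t`. -/
def zigzagCol (n k m t : ℕ) : List ℕ :=
  (List.range k).map fun i => if i = 0 then t + 1 else if i < m then n + i else n + i + 1

theorem length_zigzagCol (n k m t : ℕ) : (zigzagCol n k m t).length = k := by
  simp [zigzagCol]

theorem getElem?_zigzagCol {n k m t i a : ℕ} (h : (zigzagCol n k m t)[i]? = some a) :
    i < k ∧ a = if i = 0 then t + 1 else if i < m then n + i else n + i + 1 := by
  obtain ⟨hi, rfl⟩ := List.getElem?_eq_some_iff.1 h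
  refine ⟨by simpa [zigzagCol] using hi, by simp [zigzagCol]⟩

theorem pairwise_zigzagCol {n k m t : ℕ} (ht : t < n) :
    (zigzagCol n k m t).Pairwise (· < ·) := by
  rw [List.pairwise_iff_getElem]
  intro i j hi hj hij
  simp only [zigzagCol, List.getElem_map, List.getElem_range]
  split_ifs <;> omega

theorem word_zigzag_mul {σ : Equiv.Perm ℕ} {n k m t : ℕ} (hσ : ∀ x, n ≤ x → σ x = x)
    (hm : 0 < m) (hmk : m ≤ k) (ht : t < n) :
    word (zigzag n k m t hm hmk ht * σ) (n + k) =
      word (zigzag n k m t hm hmk ht * σ) n ++ (zigzagCol n k m t).reverse := by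
  rw [word, List.range_add, List.map_append, word]
  congr 1
  apply List.ext_getElem
  · simp [zigzagCol]
  · intro i hi _
    have hik : i < k := by simpa using hi
    simp only [List.map_map, List.getElem_map, List.getElem_range, Function.comp_apply,
      Equiv.Perm.mul_apply, List.getElem_reverse, zigzagCol, List.length_map, List.length_range]
    rw [hσ _ (by omega), zigzag_add hm hmk ht hik]
    split_ifs <;> omega

theorem mem_word_le {σ : Equiv.Perm ℕ} {n : ℕ} {F : Set ℕ} (h : CyclicOutside σ n F) {x : ℕ}
    (hx : x ∈ word σ n) : x ≤ n := by
  simp only [word, List.mem_map, List.mem_range] at hx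
  obtain ⟨i, hi, rfl⟩ := hx
  exact h.apply_lt hi

theorem word_zigzag_mul_eq_map {σ : Equiv.Perm ℕ} {n k m : ℕ} {F : Set ℕ}
    (h : CyclicOutside σ n F) (hm : 0 < m) (hmk : m ≤ k) (hn : n - 1 < n) :
    word (zigzag n k m (n - 1) hm hmk hn * σ) n =
      (word σ n).map fun x => if x < n then x else x + m := by
  rw [word, word, List.map_map]
  apply List.map_congr_left
  intro i hi
  have h1 := h.apply_lt (List.mem_range.1 hi)
  simp only [Equiv.Perm.mul_apply, Function.comp_apply]
  by_cases h2 : σ i = n - 1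
  · rw [h2, zigzag_self, if_neg (by omega)]
    omega
  · rw [zigzag_of_lt hm hmk hn h1 h2, if_pos (by omega)]

theorem mem_getD_le {σ : Equiv.Perm ℕ} {n : ℕ} {F : Set ℕ} (h : CyclicOutside σ n F) {x i : ℕ}
    (hx : x ∈ (insertionTableau (word σ n)).getD i []) : x ≤ n := by
  apply mem_word_le h (mem_of_mem_insertionTableau (List.mem_flatten.2 ⟨_, ?_, hx⟩))
  rw [List.getD_eq_getElem?_getD] at hx ⊢
  rcases hi : (insertionTableau (word σ n))[i]? with _ | r
  · simp [hi] at hx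
  · exact List.mem_of_getElem? hi

/-- The insertion tableau of `σ` has row lengths `l` and last column of height `h`, and its
largest entry, which is not a fixed point of `σ`, is in the lower half of that column or
below. The elements of `F` are fixed by `σ` and the others form a cycle. -/
structure Extendable (σ : Equiv.Perm ℕ) (n h : ℕ) (l : List ℕ) (F : Set ℕ) : Prop where
  cyclicOutside : CyclicOutside σ n F
  pos : 0 < n
  not_mem : n - 1 ∉ F
  lengths : (insertionTableau (word σ n)).map List.length = l
  not_mem_row : ∀ i < (h + 1) / 2, n ∉ (insertionTableau (word σ n)).getD i []

theorem zigzag_last_not_mem {n k m t : ℕ} {F : Set ℕ} (hF : ∀ x ∈ F, x < n)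
    (hm : 0 < m) (hmk : m ≤ k) (ht : t < n) :
    n + k - 1 ∉ F ∪ {x | n ≤ x ∧ x < n + k ∧ zigzag n k m t hm hmk ht x = x} := by
  rintro (h | h)
  · have := hF _ h
    omega
  · have h1 := h.2.2
    rw [show n + k - 1 = n + (k - 1) by omega,
      zigzag_eq_self_iff hm hmk ht (by omega)] at h1
    omega

/-- With `t = n - 1` the old word is relabelled by the increasing map `g`, which sends its largest
letter `n` to `n + m`. Only this letter can obstruct the new column, and only in the rows above `m`.
The invariant excludes it there, since `m ≤ (k + 1) / 2 ≤ (h + 1) / 2`. -/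
theorem Extendable.zigzag_mul {σ : Equiv.Perm ℕ} {n h k m : ℕ} {l : List ℕ} {F : Set ℕ}
    (hσ : Extendable σ n h l F) (hk : k ≤ h) (hm : 0 < m) (h1 : 2 * m ≤ k + 1)
    (h2 : k ≤ 2 * m + 1) (hmk : m ≤ k) (hn : n - 1 < n) :
    Extendable (zigzag n k m (n - 1) hm hmk hn * σ) (n + k) k (addCol l k)
      (F ∪ {x | n ≤ x ∧ x < n + k ∧ zigzag n k m (n - 1) hm hmk hn x = x}) := by
  set g : ℕ → ℕ := fun x => if x < n then x else x + m with hg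
  have hgm : StrictMono g := by
    intro x y hxy
    simp only [hg]
    split_ifs <;> omega
  have hcyc := hσ.cyclicOutside
  have hword := word_zigzag_mul_eq_map hcyc hm hmk hn
  have hrow : ∀ i, ∀ x ∈ (insertionTableau ((word σ n).map g)).getD i [],
      ∃ y ∈ (insertionTableau (word σ n)).getD i [], g y = x := by
    intro i x hx
    rw [insertionTableau_map hgm, List.getD_eq_getElem?_getD, List.getElem?_map] at hx
    rw [List.getD_eq_getElem?_getD]
    rcases hi : (insertionTableau (word σ n))[i]? with _ | r
    · simp [hi] at hx
    · simpa [hi] using hx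
  have hfit : FitsCol (insertionTableau ((word σ n).map g)) (zigzagCol n k m (n - 1)) := by
    intro i x hx a ha
    obtain ⟨y, hy, rfl⟩ := hrow i x hx
    obtain ⟨hik, rfl⟩ := getElem?_zigzagCol ha
    have hyn := mem_getD_le hcyc hy
    have hlow : i < m → y ≠ n := by
      rintro him rfl
      exact hσ.not_mem_row i (by omega) hy
    simp only [hg]
    split_ifs <;> omega
  have htab := insertionTableau_append_reverse (pairwise_zigzagCol hn) hfit
  rw [← hword, ← word_zigzag_mul hcyc.apply_of_ge, hword] at htab
  refine ⟨hcyc.zigzag_mul hm hmk hn hσ.not_mem (by omega) h2, by omega,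
    zigzag_last_not_mem hcyc.lt_of_mem hm hmk hn, ?_, ?_⟩
  · rw [htab, map_length_appendCol, length_zigzagCol, ← hσ.lengths, insertionTableau_map hgm]
    simp [Function.comp_def]
  · intro i hi hmem
    rw [htab] at hmem
    -- The new largest letter `n + k` ends the new column, unless `m = k = 1`. In that case it is
    -- the relabelled old maximum, whose row is already controlled.
    rcases mem_getD_appendCol hmem with hmem | hmem
    · obtain ⟨y, hy, hgy⟩ := hrow i _ hmem
      have hyn := mem_getD_le hcyc hy
      have hlow : i < (h + 1) / 2 → y ≠ n := by
        rintro him rfl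
        exact hσ.not_mem_row i him hy
      simp only [hg] at hgy
      split_ifs at hgy <;> omega
    · obtain ⟨hik, hk'⟩ := getElem?_zigzagCol hmem
      split_ifs at hk' <;> omega

/-- The first column, of height `l`, in a tableau with two columns. -/
def firstCol (l m v : ℕ) : List ℕ :=
  (List.range l).map fun i => if i < v then i + 1 else if i + 1 = l then l + m else i + 2

/-- The first zigzag, from the identity on `{0}`, gives a cycle whose word is decreasing except for
its first letter `v + 1`. The second zigzag takes `t = v`: it replaces that letter by `l + m`, which
makes the first `l` letters decreasing, and puts `v + 1` on top of the second column. -/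
theorem extendable_twoCol {l k m v : ℕ} (hv : 0 < v) (hvl : v ≤ l - 1) (hm : 0 < m) (hmk : m ≤ k)
    (hkl : k ≤ l) (h1 : 2 * m ≤ k + 1) (h2 : k ≤ 2 * m + 1) (h3 : 2 * v ≤ l + 1)
    (h4 : l ≤ 2 * v + 2) (h01 : 0 < 1) (hl : v < 1 + (l - 1)) :
    Extendable (zigzag (1 + (l - 1)) k m v hm hmk hl * (zigzag 1 (l - 1) v 0 hv hvl h01 * 1))
      (1 + (l - 1) + k) k (addCol (List.replicate l 1) k)
      ((∅ ∪ {x | 1 ≤ x ∧ x < 1 + (l - 1) ∧ zigzag 1 (l - 1) v 0 hv hvl h01 x = x}) ∪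
        {x | 1 + (l - 1) ≤ x ∧ x < 1 + (l - 1) + k ∧
          zigzag (1 + (l - 1)) k m v hm hmk hl x = x}) := by
  have hll : 1 + (l - 1) = l := by omega
  have hone : CyclicOutside 1 1 ∅ := by
    refine ⟨fun x _ => rfl, fun x y hx hy _ _ => ?_, by simp, by simp⟩
    rw [show x = y by omega]
  have hc1 := hone.zigzag_mul hv hvl h01 (by simp) (by omega) (by omega)
  have hv1 : v ∉ (∅ ∪ {x | 1 ≤ x ∧ x < 1 + (l - 1) ∧
      zigzag 1 (l - 1) v 0 hv hvl h01 x = x} : Set ℕ) := by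
    rintro (h | h)
    · exact h
    · have h5 := h.2.2
      have h6 := zigzag_eq_self_iff hv hvl h01 (i := v - 1) (by omega)
      rw [show 1 + (v - 1) = v by omega] at h6
      have h7 := h6.1 h5
      omega
  have hc2 := hc1.zigzag_mul hm hmk hl hv1 (by omega) h2
  have hword : word (zigzag (1 + (l - 1)) k m v hm hmk hl *
      (zigzag 1 (l - 1) v 0 hv hvl h01 * 1)) (1 + (l - 1)) =
      [] ++ (firstCol l m v).reverse := by
    apply List.ext_getElem
    · simp [firstCol, word, hll]
    · intro i hi _
      have hil : i < l := by simpa [word, hll] using hi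
      simp only [word, firstCol, List.getElem_map, List.getElem_range, Equiv.Perm.mul_apply,
        List.nil_append, List.getElem_reverse, List.length_map, List.length_range,
        Equiv.Perm.one_apply]
      rcases Nat.eq_zero_or_pos i with rfl | hi0
      -- Position 0 is sent to `v` by the first zigzag and on to `l + m - 1` by the second.
      · rw [zigzag_self, show 1 + v - 1 = v by omega, zigzag_self]
        split_ifs <;> omega
      · have h6 := zigzag_add hv hvl h01 (i := i - 1) (by omega)
        rw [show 1 + (i - 1) = i by omega] at h6
        rw [h6]
        split_ifs <;>
        first
          | omega
          | (rw [zigzag_of_lt hm hmk hl (by omega) (by omega)]; omega)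
  have hfirst : (firstCol l m v).Pairwise (· < ·) := by
    rw [List.pairwise_iff_getElem]
    intro i j hi hj hij
    simp only [firstCol, List.length_map, List.length_range] at hi hj
    simp only [firstCol, List.getElem_map, List.getElem_range]
    split_ifs <;> omega
  have htab1 := insertionTableau_append_reverse (w := []) hfirst (fitsCol_nil_left _)
  rw [← hword] at htab1
  have hrow : ∀ i, ∀ x ∈ (appendCol (insertionTableau []) (firstCol l m v)).getD i [],
      i < l ∧ x = if i < v then i + 1 else if i + 1 = l then l + m else i + 2 := by
    intro i x hx
    rcases mem_getD_appendCol hx with hx | hx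
    · simp [insertionTableau] at hx
    · obtain ⟨hi, rfl⟩ := List.getElem?_eq_some_iff.1 hx
      refine ⟨by simpa [firstCol] using hi, by simp [firstCol]⟩
  have hfit : FitsCol (insertionTableau (word (zigzag (1 + (l - 1)) k m v hm hmk hl *
      (zigzag 1 (l - 1) v 0 hv hvl h01 * 1)) (1 + (l - 1)))) (zigzagCol (1 + (l - 1)) k m v) := by
    rw [htab1]
    intro i x hx a ha
    obtain ⟨hil, rfl⟩ := hrow i x hx
    obtain ⟨hik, rfl⟩ := getElem?_zigzagCol ha
    split_ifs <;> omega
  have htab := insertionTableau_append_reverse (pairwise_zigzagCol hl) hfit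
  rw [← word_zigzag_mul hc1.apply_of_ge, htab1] at htab
  refine ⟨hc2, by omega, zigzag_last_not_mem hc1.lt_of_mem hm hmk hl, ?_, ?_⟩
  · rw [htab, map_length_appendCol, map_length_appendCol, length_zigzagCol]
    simp [insertionTableau, firstCol, addCol_nil]
  · intro i hi hmem
    rw [htab] at hmem
    rcases mem_getD_appendCol hmem with hmem | hmem
    · obtain ⟨hil, hx⟩ := hrow i _ hmem
      split_ifs at hx <;> omega
    · obtain ⟨hik, hk'⟩ := getElem?_zigzagCol hmem
      split_ifs at hk' <;> omega

/-! ### Realizing every shape by a cycle, with or without a fixed point -/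

theorem Extendable.exists_addCol {σ : Equiv.Perm ℕ} {n h k : ℕ} {l : List ℕ} {F : Set ℕ}
    (hσ : Extendable σ n h l F) (hk : 0 < k) (hkh : k ≤ h) :
    ∃ σ', Extendable σ' (n + k) k (addCol l k) F := by
  have hn : n - 1 < n := by have := hσ.pos; omega
  have := hσ.zigzag_mul (m := (k + 1) / 2) hkh (by omega) (by omega) (by omega) (by omega) hn
  rw [setOf_zigzag_eq_empty _ _ _ (by omega), Set.union_empty] at this
  exact ⟨_, this⟩

theorem Extendable.exists_addCol_of_odd {σ : Equiv.Perm ℕ} {n h k : ℕ} {l : List ℕ}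
    (hσ : Extendable σ n h l ∅) (hk : 3 ≤ k) (hkh : k ≤ h) (hodd : k % 2 = 1) :
    ∃ σ' f, Extendable σ' (n + k) k (addCol l k) {f} := by
  have hn : n - 1 < n := by have := hσ.pos; omega
  have := hσ.zigzag_mul (m := (k - 1) / 2) hkh (by omega) (by omega) (by omega) (by omega) hn
  rw [setOf_zigzag_eq_singleton _ _ _ (by omega), Set.empty_union] at this
  exact ⟨_, _, this⟩

theorem exists_extendable_two {l k : ℕ} (hl : 2 ≤ l) (hk : 0 < k) (hkl : k ≤ l) :
    ∃ σ, Extendable σ (l + k) k (addCol (List.replicate l 1) k) ∅ := by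
  have := extendable_twoCol (l := l) (k := k) (m := (k + 1) / 2) (v := l / 2) (by omega) (by omega)
    (by omega) (by omega) hkl (by omega) (by omega) (by omega) (by omega) one_pos (by omega)
  rw [setOf_zigzag_eq_empty _ _ _ (by omega), setOf_zigzag_eq_empty _ _ _ (by omega),
    Set.union_empty, Set.union_empty] at this
  simp only [show 1 + (l - 1) = l by omega] at this
  exact ⟨_, this⟩

/-- The fixed point arises in the first zigzag if `l` is odd and in the second if `k` is odd. For `k
= 1` the second has no room, so `v` is lowered instead. This needs `l ≥ 4`, hence the exclusion of
`l + k = 3`. -/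
theorem exists_extendable_two_of_odd {l k : ℕ} (hl : 2 ≤ l) (hk : 0 < k) (hkl : k ≤ l)
    (hodd : (l + k) % 2 = 1) (hlk : 3 < l + k) :
    ∃ σ f, Extendable σ (l + k) k (addCol (List.replicate l 1) k) {f} := by
  by_cases hl2 : l % 2 = 1
  · have := extendable_twoCol (l := l) (k := k) (m := (k + 1) / 2) (v := (l + 1) / 2) (by omega)
      (by omega) (by omega) (by omega) hkl (by omega) (by omega) (by omega) (by omega) one_pos
      (by omega)
    rw [setOf_zigzag_eq_singleton' _ _ _ (by omega), setOf_zigzag_eq_empty _ _ _ (by omega),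
      Set.union_empty, Set.empty_union] at this
    simp only [show 1 + (l - 1) = l by omega] at this
    exact ⟨_, _, this⟩
  · by_cases hk1 : k = 1
    · have := extendable_twoCol (l := l) (k := k) (m := (k + 1) / 2) (v := l / 2 - 1) (by omega)
        (by omega) (by omega) (by omega) hkl (by omega) (by omega) (by omega) (by omega) one_pos
        (by omega)
      rw [setOf_zigzag_eq_singleton _ _ _ (by omega), setOf_zigzag_eq_empty _ _ _ (by omega),
        Set.union_empty, Set.empty_union] at this
      simp only [show 1 + (l - 1) = l by omega] at this
      exact ⟨_, _, this⟩
    · have := extendable_twoCol (l := l) (k := k) (m := (k - 1) / 2) (v := l / 2) (by omega)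
        (by omega) (by omega) (by omega) hkl (by omega) (by omega) (by omega) (by omega) one_pos
        (by omega)
      rw [setOf_zigzag_eq_empty _ _ _ (by omega), setOf_zigzag_eq_singleton _ _ _ (by omega),
        Set.empty_union, Set.empty_union] at this
      simp only [show 1 + (l - 1) = l by omega] at this
      exact ⟨_, _, this⟩

/-- `l` is the list of row lengths of the insertion tableau of a permutation of
`{0, …, n - 1}` that has at most one cycle outside the set `F` of fixed points. -/
def Realizes (n : ℕ) (l : List ℕ) (F : Set ℕ) : Prop :=
  ∃ σ, CyclicOutside σ n F ∧ (insertionTableau (word σ n)).map List.length = l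

theorem Extendable.realizes {σ : Equiv.Perm ℕ} {n h : ℕ} {l : List ℕ} {F : Set ℕ}
    (hσ : Extendable σ n h l F) : Realizes n l F :=
  ⟨σ, hσ.cyclicOutside, hσ.lengths⟩

/-- A new largest letter, appended as a fixed point, lengthens the first row. The result is not
`Extendable`, because its largest letter is fixed. -/
theorem Realizes.addCol_one {n : ℕ} {l : List ℕ} (h : Realizes n l ∅) :
    Realizes (n + 1) (addCol l 1) {n} := by
  obtain ⟨σ, hσ, hl⟩ := h
  refine ⟨σ, ⟨fun x hx => hσ.apply_of_ge x (by omega), fun x y hx hy hxn hyn => ?_, ?_, ?_⟩, ?_⟩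
  · rw [Set.mem_singleton_iff] at hxn hyn
    exact hσ.sameCycle x y (by omega) (by omega) (by simp) (by simp)
  · simp
  · rintro x rfl
    exact hσ.apply_of_ge _ le_rfl
  · have hw : word σ (n + 1) = word σ n ++ [n + 1].reverse := by
      rw [word, List.range_succ, List.map_append, word]
      simp [hσ.apply_of_ge n le_rfl]
    rw [hw, insertionTableau_append_reverse (by simp), map_length_appendCol, hl]
    · rfl
    · intro i x hx a ha
      have h1 := mem_getD_le hσ hx
      have h2 : a ∈ [n + 1] := List.mem_of_getElem? ha
      simp at h2
      omega

theorem realizes_two : Realizes 2 [1, 1] ∅ := by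
  refine ⟨Equiv.swap 0 1, ⟨fun x hx => ?_, fun x y hx hy _ _ => ?_, by simp, by simp⟩, ?_⟩
  · exact Equiv.swap_apply_of_ne_of_ne (by omega) (by omega)
  · have h01 : (Equiv.swap 0 1 : Equiv.Perm ℕ).SameCycle 0 1 := ⟨1, by simp⟩
    interval_cases x <;> interval_cases y
    · exact Equiv.Perm.SameCycle.refl _ _
    · exact h01
    · exact h01.symm
    · exact Equiv.Perm.SameCycle.refl _ _
  · decide

theorem sum_map_min_succ (L : List ℕ) (j : ℕ) :
    (L.map (min (j + 1))).sum = (L.map (min j)).sum + L.countP (j < ·) := by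
  induction L with
  | nil => rfl
  | cons a L ih =>
    rw [List.map_cons, List.map_cons, List.sum_cons, List.sum_cons, List.countP_cons, ih]
    simp only [decide_eq_true_eq]
    split_ifs <;> omega

theorem countP_lt_anti (L : List ℕ) (j : ℕ) : L.countP (j + 1 < ·) ≤ L.countP (j < ·) := by
  apply List.countP_mono_left
  intro x _
  simp only [decide_eq_true_eq]
  omega

theorem map_min_one {L : List ℕ} (hpos : ∀ x ∈ L, 0 < x) :
    L.map (min 1) = List.replicate L.length 1 := by
  rw [List.eq_replicate_iff]
  refine ⟨by simp, fun x hx => ?_⟩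
  obtain ⟨y, hy, rfl⟩ := List.mem_map.1 hx
  have := hpos y hy
  omega

theorem exists_extendable_map_min {L : List ℕ} (hL : L.Pairwise (· ≥ ·))
    (hpos : ∀ x ∈ L, 0 < x) (hlen : 2 ≤ L.length)
    (hone : 0 < L.countP (1 < ·)) (j : ℕ) :
    ∃ σ, Extendable σ (L.map (min (j + 2))).sum (L.countP (j + 1 < ·)) (L.map (min (j + 2))) ∅ := by
  induction j with
  | zero =>
    have h := exists_extendable_two hlen hone List.countP_le_length
    rw [← map_min_one hpos, addCol_map_min hL] at h
    rw [sum_map_min_succ, map_min_one hpos]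
    simpa [map_min_one hpos] using h
  | succ j ih =>
    obtain ⟨σ, hσ⟩ := ih
    have hle := countP_lt_anti L (j + 1)
    rw [show j + 1 + 2 = j + 2 + 1 by ring, sum_map_min_succ, ← addCol_map_min hL (j + 2)]
    rcases Nat.eq_zero_or_pos (L.countP (j + 2 < ·)) with h0 | h0
    · rw [show j + 1 + 1 = j + 2 by ring, h0]
      -- For a column of height 0 the row condition is vacuous, as `(0 + 1) / 2 = 0`.
      exact ⟨σ, hσ.cyclicOutside, hσ.pos, hσ.not_mem, by simpa using hσ.lengths, by simp⟩
    · exact hσ.exists_addCol h0 hle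

/-- A column of even height keeps the fixed point obtained so far. A column of odd height starts
again from the full cycle on the columns before it and creates the fixed point there. The second
alternative covers fixed points appended as a column of height one; since later columns have height
at most one, that permutation never has to be extended by a zigzag. -/
theorem exists_extendable_map_min_of_odd {L : List ℕ} (hL : L.Pairwise (· ≥ ·))
    (hpos : ∀ x ∈ L, 0 < x) (hlen : 2 ≤ L.length)
    (hone : 0 < L.countP (1 < ·)) (j : ℕ) (hodd : (L.map (min (j + 2))).sum % 2 = 1) :
    (∃ σ f, Extendable σ (L.map (min (j + 2))).sum (L.countP (j + 1 < ·))
      (L.map (min (j + 2))) {f}) ∨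
    (L.countP (j + 1 < ·) ≤ 1 ∧
      ∃ f, Realizes (L.map (min (j + 2))).sum (L.map (min (j + 2))) {f}) := by
  induction j with
  | zero =>
    have hsum : (L.map (min (0 + 2))).sum = L.length + L.countP (1 < ·) := by
      rw [sum_map_min_succ, map_min_one hpos]
      simp
    have hle : L.countP (1 < ·) ≤ L.length := List.countP_le_length
    rw [hsum] at hodd ⊢
    rw [← addCol_map_min hL (0 + 1), map_min_one hpos]
    -- The exceptional shape (2, 1) comes from a transposition followed by a fixed point.
    by_cases h3 : L.length + L.countP (1 < ·) = 3
    · right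
      have h1 : L.countP (1 < ·) = 1 := by omega
      have h2 : L.length = 2 := by omega
      simp only [zero_add, h1, h2]
      exact ⟨le_rfl, _, realizes_two.addCol_one⟩
    · left
      exact exists_extendable_two_of_odd hlen hone hle hodd (by omega)
  | succ j ih =>
    have hle := countP_lt_anti L (j + 1)
    rw [show j + 1 + 1 = j + 2 by ring]
    rw [show j + 1 + 2 = j + 2 + 1 by ring, sum_map_min_succ] at hodd ⊢
    rw [← addCol_map_min hL (j + 2)]
    rcases Nat.even_or_odd' (L.countP (j + 2 < ·)) with ⟨a, ha | ha⟩
    · rcases ih (by omega) with ⟨σ, f, hσ⟩ | ⟨h1, h⟩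
      · left
        rcases Nat.eq_zero_or_pos (L.countP (j + 2 < ·)) with h0 | h0
        · rw [h0]
          exact ⟨σ, f, hσ.cyclicOutside, hσ.pos, hσ.not_mem, by simpa using hσ.lengths, by simp⟩
        · obtain ⟨σ', h⟩ := hσ.exists_addCol h0 hle
          exact ⟨σ', f, h⟩
      · right
        have h0 : L.countP (j + 2 < ·) = 0 := by
          rw [show j + 1 + 1 = j + 2 by ring] at hle
          omega
        rw [h0, addCol_zero]
        exact ⟨zero_le_one, h⟩
    · obtain ⟨σ, hσ⟩ := exists_extendable_map_min hL hpos hlen hone j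
      by_cases ha0 : a = 0
      · right
        have h1 : L.countP (j + 2 < ·) = 1 := by omega
        rw [h1]
        exact ⟨le_rfl, _, hσ.realizes.addCol_one⟩
      · left
        exact hσ.exists_addCol_of_odd (by omega) hle (by omega)

theorem map_min_eq_self {L : List ℕ} {j : ℕ} (h : ∀ x ∈ L, x ≤ j) : L.map (min j) = L := by
  nth_rewrite 2 [← List.map_id L]
  apply List.map_congr_left
  intro x hx
  simpa using h x hx

theorem realizes_of_pairwise {L : List ℕ} (hL : L.Pairwise (· ≥ ·))
    (hpos : ∀ x ∈ L, 0 < x) (hlen : 2 ≤ L.length)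
    (hone : 0 < L.countP (1 < ·)) :
    Realizes L.sum L ∅ ∧ (L.sum % 2 = 1 → ∃ f, Realizes L.sum L {f}) := by
  have h := map_min_eq_self (L := L) (j := L.sum + 2)
    fun x hx => (List.le_sum_of_mem hx).trans (by omega)
  have h1 := exists_extendable_map_min hL hpos hlen hone L.sum
  have h2 := exists_extendable_map_min_of_odd hL hpos hlen hone L.sum
  rw [h] at h1 h2
  refine ⟨h1.elim fun σ hσ => hσ.realizes, fun hodd => ?_⟩
  rcases h2 hodd with ⟨σ, f, hσ⟩ | ⟨_, hf⟩
  · exact ⟨f, hσ.realizes⟩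
  · exact hf

/-! ### Transfer to permutations of `Fin n` and their cycle types -/

theorem partition_parts_of_isCycle {n : ℕ} {τ : Equiv.Perm (Fin n)} (h : τ.IsCycle) :
    τ.partition.parts = {τ.support.card} + Multiset.replicate (n - τ.support.card) 1 := by
  rw [Equiv.Perm.parts_partition, h.cycleType, Fintype.card_fin]

theorem partition_parts_of_sameCycle {n : ℕ} {τ : Equiv.Perm (Fin n)} (hn : 2 ≤ n)
    (h : ∀ x y, τ.SameCycle x y) : τ.partition.parts = {n} := by
  have hne : ∀ x, τ x ≠ x := by
    intro x hx
    obtain ⟨y, hy⟩ : ∃ y, y ≠ x := by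
      have : Nontrivial (Fin n) := Fin.nontrivial_iff_two_le.2 hn
      exact exists_ne x
    exact hy ((h x y).eq_of_left hx).symm
  have hcyc : τ.IsCycle := ⟨⟨0, by omega⟩, hne _, fun y _ => h _ y⟩
  have hsupp : τ.support = Finset.univ := by
    ext x
    simp [hne x]
  rw [partition_parts_of_isCycle hcyc, hsupp]
  simp

theorem partition_parts_of_sameCycle_of_ne {n : ℕ} {τ : Equiv.Perm (Fin n)} (hn : 3 ≤ n)
    {f : Fin n} (hf : τ f = f) (h : ∀ x y, x ≠ f → y ≠ f → τ.SameCycle x y) :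
    τ.partition.parts = {n - 1, 1} := by
  have hne : ∀ x, x ≠ f → τ x ≠ x := by
    intro x hxf hx
    obtain ⟨y, hy⟩ : ∃ y, y ∉ ({x, f} : Finset (Fin n)) := by
      by_contra hall
      push Not at hall
      have h1 := Finset.card_le_card (fun y _ => hall y : (Finset.univ : Finset (Fin n)) ⊆ {x, f})
      have h2 := Finset.card_le_two (a := x) (b := f)
      rw [Finset.card_univ, Fintype.card_fin] at h1
      omega
    simp only [Finset.mem_insert, Finset.mem_singleton, not_or] at hy
    exact hy.1 ((h x y hxf hy.2).eq_of_left hx).symm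
  have hsupp : τ.support = Finset.univ.erase f := by
    ext x
    by_cases hx : x = f
    · simp [hx, hf]
    · simp [hx, hne x hx]
  have hcard : τ.support.card = n - 1 := by
    rw [hsupp, Finset.card_erase_of_mem (Finset.mem_univ _), Finset.card_univ, Fintype.card_fin]
  obtain ⟨x, hx⟩ : τ.support.Nonempty := by
    rw [← Finset.card_pos]
    omega
  have hxf : x ≠ f := by
    rintro rfl
    exact Equiv.Perm.mem_support.1 hx hf
  have hcyc : τ.IsCycle := ⟨x, hne x hxf, fun y hy => h _ _ hxf fun hyf => hy (hyf ▸ hf)⟩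
  rw [partition_parts_of_isCycle hcyc, hcard, show n - (n - 1) = 1 by omega]
  rfl

theorem CyclicOutside.exists_perm_fin {σ : Equiv.Perm ℕ} {n : ℕ} {F : Set ℕ}
    (h : CyclicOutside σ n F) :
    ∃ τ : Equiv.Perm (Fin n), oneLine τ = word σ n ∧ (∀ x, (τ x : ℕ) = σ x) ∧
      ∀ x y : Fin n, (x : ℕ) ∉ F → (y : ℕ) ∉ F → τ.SameCycle x y := by
  have hsymm : ∀ x, x < n → σ.symm x < n := by
    intro x hx
    simpa using h.zpow_apply_lt (-1) hx
  let τ : Equiv.Perm (Fin n) :=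
    { toFun := fun i => ⟨σ i, h.apply_lt i.2⟩
      invFun := fun i => ⟨σ.symm i, hsymm i i.2⟩
      left_inv := fun i => by simp
      right_inv := fun i => by simp }
  have hτ : ∀ x, (τ x : ℕ) = σ x := fun x => rfl
  have hext : τ.extendDomain Fin.equivSubtype = σ := by
    ext x
    by_cases hx : x < n
    · exact Equiv.Perm.extendDomain_apply_subtype τ Fin.equivSubtype hx
    · rw [h.apply_of_ge x (by omega)]
      exact Equiv.Perm.extendDomain_apply_not_subtype τ Fin.equivSubtype hx
  refine ⟨τ, ?_, hτ, fun x y hx hy => ?_⟩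
  · apply List.ext_getElem
    · simp [oneLine, word]
    · intro i h1 h2
      simp [oneLine, word, hτ]
  · rw [← Equiv.Perm.sameCycle_extendDomain (f := Fin.equivSubtype), hext]
    exact h.sameCycle _ _ x.2 y.2 hx hy

theorem Realizes.exists_perm_fin {n : ℕ} {l : List ℕ} {F : Set ℕ} (h : Realizes n l F) :
    ∃ τ : Equiv.Perm (Fin n), rskShape τ = l ∧ (∀ x : Fin n, (x : ℕ) ∈ F → τ x = x) ∧
      ∀ x y : Fin n, (x : ℕ) ∉ F → (y : ℕ) ∉ F → τ.SameCycle x y := by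
  obtain ⟨σ, hσ, hl⟩ := h
  obtain ⟨τ, hw, hτ, hcyc⟩ := hσ.exists_perm_fin
  refine ⟨τ, ?_, fun x hx => Fin.ext ?_, hcyc⟩
  · rw [rskShape, tableauShape, hw, hl]
  · rw [hτ, hσ.apply_of_mem x hx]

theorem realizes_of_partition {n : ℕ} (hn : 0 < n) (μ : n.Partition) (h1 : μ.parts ≠ {n})
    (h2 : μ.parts ≠ Multiset.replicate n 1) :
    3 ≤ n ∧ ∃ l : List ℕ, (l : Multiset ℕ) = μ.parts ∧ Realizes n l ∅ ∧
      (n % 2 = 1 → ∃ f, Realizes n l {f}) := by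
  have hcoe : ((μ.parts.sort (· ≥ ·) : List ℕ) : Multiset ℕ) = μ.parts := Multiset.sort_eq _ _
  set l := μ.parts.sort (· ≥ ·) with hl
  have hmem : ∀ x, x ∈ l ↔ x ∈ μ.parts := by
    intro x
    rw [← hcoe, Multiset.mem_coe]
  have hsum : l.sum = n := by rw [← Multiset.sum_coe, hcoe, μ.parts_sum]
  have hpos : ∀ x ∈ l, 0 < x := fun x hx => μ.parts_pos ((hmem x).1 hx)
  have hlen : 2 ≤ l.length := by
    by_contra hlt
    rcases hl' : l with _ | ⟨a, _ | ⟨b, l'⟩⟩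
    · simp [hl'] at hsum
      omega
    · simp [hl'] at hsum
      rw [hl', hsum] at hcoe
      exact h1 hcoe.symm
    · simp [hl'] at hlt
  have hone : 0 < l.countP (1 < ·) := by
    rw [List.countP_pos_iff]
    by_contra hall
    push Not at hall
    have hrep : l = List.replicate l.length 1 := by
      rw [List.eq_replicate_iff]
      refine ⟨rfl, fun x hx => ?_⟩
      have := hpos x hx
      have := hall x hx
      simp at this
      omega
    have hlen' : l.length = n := by
      rw [hrep] at hsum
      simpa using hsum
    rw [hrep, hlen'] at hcoe
    exact h2 hcoe.symm
  have hpw : l.Pairwise (· ≥ ·) := Multiset.pairwise_sort _ _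
  have := realizes_of_pairwise hpw hpos hlen hone
  rw [hsum] at this
  -- Two rows, one of them longer than 1, need at least three boxes.
  refine ⟨?_, l, hcoe, this⟩
  by_contra hlt
  obtain ⟨x, hx, hx1⟩ := List.countP_pos_iff.1 hone
  simp at hx1
  rcases hl' : l with _ | ⟨a, _ | ⟨b, l'⟩⟩
  · simp [hl'] at hlen
  · simp [hl'] at hlen
  · have ha := hpos a (by simp [hl'])
    have hb := hpos b (by simp [hl'])
    rw [hl'] at hx
    simp [hl'] at hsum
    rcases List.mem_cons.1 hx with rfl | hx
    · omega
    · rcases List.mem_cons.1 hx with rfl | hx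
      · omega
      · have := List.le_sum_of_mem hx
        omega

theorem isRSKComplete_of_parts_eq {n : ℕ} (hn : 0 < n) {c : n.Partition} (hc : c.parts = {n}) :
    IsRSKCompleteCycleDecomposition c := by
  intro μ h1 h2
  obtain ⟨hn3, l, hl, h, -⟩ := realizes_of_partition hn μ h1 h2
  obtain ⟨τ, hτ, -, hcyc⟩ := h.exists_perm_fin
  refine ⟨τ, ?_, hτ.trans hl⟩
  rw [permsWithCycleDecomposition, Set.mem_ofPred_eq, hc]
  exact partition_parts_of_sameCycle (by omega) fun x y => hcyc x y (by simp) (by simp)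

theorem isRSKComplete_of_parts_eq_of_odd {n : ℕ} (hn : 0 < n) (hodd : Odd n) {c : n.Partition}
    (hc : c.parts = {n - 1, 1}) : IsRSKCompleteCycleDecomposition c := by
  intro μ h1 h2
  obtain ⟨hn3, l, hl, -, h⟩ := realizes_of_partition hn μ h1 h2
  obtain ⟨f, hf⟩ := h (Nat.odd_iff.1 hodd)
  have hfn : f < n := by
    obtain ⟨σ, hσ, -⟩ := hf
    exact hσ.lt_of_mem f rfl
  obtain ⟨τ, hτ, hfix, hcyc⟩ := hf.exists_perm_fin
  refine ⟨τ, ?_, hτ.trans hl⟩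
  rw [permsWithCycleDecomposition, Set.mem_ofPred_eq, hc]
  apply partition_parts_of_sameCycle_of_ne hn3 (f := ⟨f, hfn⟩) (hfix _ rfl)
  intro x y hx hy
  exact hcyc x y (fun h => hx (Fin.ext h)) fun h => hy (Fin.ext h)

/-! ### Letters bumped from the first row -/

/-- The row obtained by inserting the letters of a word into the row `r`. -/
def rowAfter : List ℕ → List ℕ → List ℕ
  | r, [] => r
  | r, a :: w => rowAfter (rowInsert a r).1 w

/-- The pairs (inserted letter, displaced letter) occurring when the letters of a word are inserted
into the row `r`. -/
def bumps : List ℕ → List ℕ → List (ℕ × ℕ)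
  | _, [] => []
  | r, a :: w => (rowInsert a r).2.toList.map (Prod.mk a) ++ bumps (rowInsert a r).1 w

/-- The letters displaced when the letters of a word are inserted into the row `r`. -/
def bumped (r w : List ℕ) : List ℕ :=
  (bumps r w).map Prod.snd

theorem bumped_nil (r : List ℕ) : bumped r [] = [] := rfl

theorem bumped_cons (r : List ℕ) (a : ℕ) (w : List ℕ) :
    bumped r (a :: w) = (rowInsert a r).2.toList ++ bumped (rowInsert a r).1 w := by
  simp [bumped, bumps, Function.comp_def]

theorem rowAfter_append (r u v : List ℕ) : rowAfter r (u ++ v) = rowAfter (rowAfter r u) v := by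
  induction u generalizing r with
  | nil => rfl
  | cons a u ih => exact ih _

theorem bumps_append (r u v : List ℕ) :
    bumps r (u ++ v) = bumps r u ++ bumps (rowAfter r u) v := by
  induction u generalizing r with
  | nil => rfl
  | cons a u ih => simp [bumps, ih, rowAfter]

theorem bumped_append (r u v : List ℕ) :
    bumped r (u ++ v) = bumped r u ++ bumped (rowAfter r u) v := by
  simp [bumped, bumps_append]

theorem foldl_tableauInsert_cons (r : List ℕ) (T : List (List ℕ)) (w : List ℕ) :
    w.foldl (fun T a => tableauInsert a T) (r :: T) =
      rowAfter r w :: (bumped r w).foldl (fun T a => tableauInsert a T) T := by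
  induction w generalizing r T with
  | nil => rfl
  | cons a w ih =>
    rw [List.foldl_cons, bumped_cons, rowAfter, tableauInsert]
    rcases rowInsert a r with ⟨r', _ | b⟩
    · exact ih _ _
    · simp [ih]

theorem insertionTableau_eq_cons {w : List ℕ} (hw : w ≠ []) :
    insertionTableau w = rowAfter [] w :: insertionTableau (bumped [] w) := by
  rcases w with _ | ⟨a, w⟩
  · exact absurd rfl hw
  · exact foldl_tableauInsert_cons [a] [] w

theorem rowInsert_perm (a : ℕ) (r : List ℕ) :
    ((rowInsert a r).1 ++ (rowInsert a r).2.toList).Perm (a :: r) := by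
  induction r with
  | nil => simp [rowInsert]
  | cons b r ih =>
    by_cases h : a < b
    · simp only [rowInsert, h, if_true, Option.toList_some, List.cons_append, List.perm_cons]
      exact List.perm_append_singleton b r
    · simp only [rowInsert, h, if_false, List.cons_append]
      exact (ih.cons b).trans (List.Perm.swap a b r)

theorem rowAfter_perm (r w : List ℕ) : (rowAfter r w ++ bumped r w).Perm (r ++ w) := by
  induction w generalizing r with
  | nil => simp [rowAfter, bumped_nil]
  | cons a w ih =>
    rw [← Multiset.coe_eq_coe, bumped_cons, rowAfter]
    have h1 := Multiset.coe_eq_coe.2 (ih (rowInsert a r).1)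
    have h2 := Multiset.coe_eq_coe.2 (rowInsert_perm a r)
    simp only [← Multiset.coe_add, ← Multiset.cons_coe, ← Multiset.singleton_add] at h1 h2 ⊢
    rw [add_left_comm, h1, ← add_assoc, add_comm (Multiset.ofList _) (Multiset.ofList _), h2]
    abel

theorem lt_of_rowInsert_eq_some {a b : ℕ} {r : List ℕ} (h : (rowInsert a r).2 = some b) :
    a < b := by
  induction r with
  | nil => simp [rowInsert] at h
  | cons u r ih =>
    by_cases hab : a < u
    · simp [rowInsert, hab] at h
      omega
    · simp [rowInsert, hab] at h
      exact ih h

theorem exists_rowInsert_eq_some {a x : ℕ} {r : List ℕ} (hr : r.Pairwise (· < ·)) (hx : x ∈ r)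
    (hax : a < x) : ∃ b, (rowInsert a r).2 = some b ∧ b ≤ x := by
  induction r with
  | nil => simp at hx
  | cons u r ih =>
    rw [List.pairwise_cons] at hr
    by_cases hau : a < u
    · refine ⟨u, by simp [rowInsert, hau], ?_⟩
      rcases List.mem_cons.1 hx with rfl | hx
      · exact le_rfl
      · exact (hr.1 x hx).le
    · rcases List.mem_cons.1 hx with rfl | hx
      · exact absurd hax hau
      · simpa [rowInsert, hau] using ih hr.2 hx

theorem pairwise_rowInsert {a : ℕ} {r : List ℕ} (hr : r.Pairwise (· < ·)) (ha : a ∉ r) :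
    (rowInsert a r).1.Pairwise (· < ·) := by
  induction r with
  | nil => simp [rowInsert]
  | cons u r ih =>
    rw [List.pairwise_cons] at hr
    rw [List.mem_cons, not_or] at ha
    by_cases hau : a < u
    · simp only [rowInsert, hau, if_true, List.pairwise_cons]
      exact ⟨fun x hx => hau.trans (hr.1 x hx), hr.2⟩
    · simp only [rowInsert, hau, if_false, List.pairwise_cons]
      refine ⟨fun x hx => ?_, ih hr.2 ha.2⟩
      rcases mem_or_of_mem_rowInsert hx with hx | rfl
      · exact hr.1 x hx
      · omega

theorem nodup_rowInsert_append {a : ℕ} {r w : List ℕ} (h : (r ++ a :: w).Nodup) :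
    ((rowInsert a r).1 ++ w).Nodup := by
  have h1 : ((a :: r) ++ w).Nodup := by
    rw [List.cons_append]
    exact (List.perm_middle.nodup_iff).1 h
  have h2 := (((rowInsert_perm a r).append_right w).nodup_iff).2 h1
  rw [List.append_assoc] at h2
  exact h2.sublist ((List.Sublist.refl _).append (List.sublist_append_right _ _))

theorem pairwise_rowAfter {r w : List ℕ} (hr : r.Pairwise (· < ·)) (h : (r ++ w).Nodup) :
    (rowAfter r w).Pairwise (· < ·) := by
  induction w generalizing r with
  | nil => exact hr
  | cons a w ih =>
    apply ih (pairwise_rowInsert hr _) (nodup_rowInsert_append h)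
    intro ha
    exact (List.disjoint_of_nodup_append h) ha (by simp)

theorem mem_rowAfter_or_bumped {r w : List ℕ} {x : ℕ} :
    x ∈ rowAfter r w ∨ x ∈ bumped r w ↔ x ∈ r ∨ x ∈ w := by
  simpa using (rowAfter_perm r w).mem_iff (a := x)

theorem exists_lt_of_mem_bumped {r w : List ℕ} {x : ℕ} (h : x ∈ bumped r w) :
    ∃ a ∈ w, a < x := by
  induction w generalizing r with
  | nil => simp [bumped_nil] at h
  | cons a w ih =>
    rw [bumped_cons, List.mem_append, Option.mem_toList] at h
    rcases h with h | h
    · exact ⟨a, by simp, lt_of_rowInsert_eq_some h⟩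
    · obtain ⟨b, hb, hbx⟩ := ih h
      exact ⟨b, by simp [hb], hbx⟩

theorem map_fst_bumps_sublist (r w : List ℕ) : ((bumps r w).map Prod.fst).Sublist w := by
  induction w generalizing r with
  | nil => simp [bumps]
  | cons a w ih =>
    rw [bumps]
    rcases (rowInsert a r).2 with _ | b
    · simpa using (ih _).cons a
    · simpa using ih _

theorem length_rowAfter_add (w : List ℕ) :
    (rowAfter [] w).length + (bumped [] w).length = w.length := by
  simpa using (rowAfter_perm [] w).length_eq

theorem pairwise_append_of_bumped_eq_nil {r w : List ℕ} (hr : r.Pairwise (· < ·))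
    (h : (r ++ w).Nodup) (hb : bumped r w = []) : (r ++ w).Pairwise (· < ·) := by
  induction w generalizing r with
  | nil => simpa using hr
  | cons a w ih =>
    have har : ∀ x ∈ r, x < a := by
      intro x hx
      by_contra hxa
      have hne : a ≠ x := by
        rintro rfl
        exact (List.disjoint_of_nodup_append h) hx (by simp)
      obtain ⟨b, hb', -⟩ := exists_rowInsert_eq_some (a := a) hr hx (by omega)
      simp [bumped_cons, hb'] at hb
    have hra := rowInsert_of_forall_lt har
    rw [bumped_cons, hra] at hb
    have := ih (r := r ++ [a]) (by simpa [hra] using pairwise_rowInsert hr (a := a) fun ha =>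
      (List.disjoint_of_nodup_append h) ha (by simp)) (by simpa using h) (by simpa using hb)
    simpa using this

section bumped

variable {w u v : List ℕ} {y : ℕ}

theorem bumped_nil_append_cons (u : List ℕ) (y : ℕ) (v : List ℕ) :
    bumped [] (u ++ y :: v) = (bumped [] u ++ (rowInsert y (rowAfter [] u)).2.toList) ++
      bumped (rowInsert y (rowAfter [] u)).1 v := by
  rw [bumped_append, bumped_cons, List.append_assoc]

theorem mem_of_mem_bumped_step {x : ℕ}
    (h : x ∈ bumped [] u ++ (rowInsert y (rowAfter [] u)).2.toList) : x ∈ u := by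
  have h1 := @mem_rowAfter_or_bumped [] u x
  rw [List.mem_append, Option.mem_toList] at h
  simp only [List.not_mem_nil, false_or] at h1
  rcases h with h | h
  · exact h1.1 (Or.inr h)
  · exact h1.1 (Or.inl (mem_of_rowInsert_eq_some h))

/-- Either `x` has already been bumped, or it is still in the first row and `y` bumps some letter
greater than `y`. -/
theorem exists_mem_bumped_step (hu : u.Nodup) {x : ℕ} (hx : x ∈ u) (hyx : y < x) :
    ∃ z ∈ bumped [] u ++ (rowInsert y (rowAfter [] u)).2.toList, y < z := by
  rcases mem_rowAfter_or_bumped.2 (Or.inr hx : x ∈ [] ∨ x ∈ u) with h | h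
  · obtain ⟨b, hb, -⟩ := exists_rowInsert_eq_some (pairwise_rowAfter List.Pairwise.nil hu) h hyx
    exact ⟨b, by simp [hb], lt_of_rowInsert_eq_some hb⟩
  · exact ⟨x, by simp [h], hyx⟩

/-- Letters bumped up to the insertion of `y` come from `u`, and those bumped later exceed `z`,
hence `y`. -/
theorem not_mem_bumped_of_exists_lt (hw : (u ++ y :: v).Nodup)
    (hb : (bumped [] (u ++ y :: v)).Pairwise (· < ·))
    (h : ∃ z ∈ bumped [] u ++ (rowInsert y (rowAfter [] u)).2.toList, y < z) :
    y ∉ bumped [] (u ++ y :: v) := by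
  obtain ⟨z, hz, hyz⟩ := h
  rw [bumped_nil_append_cons] at hb ⊢
  rw [List.mem_append]
  rintro (hy | hy)
  · exact (List.disjoint_of_nodup_append hw) (mem_of_mem_bumped_step hy) (by simp)
  · have := (List.pairwise_append.1 hb).2.2 z hz y hy
    omega

/-- By the previous lemma `y` stays in the first row for good. A smaller letter after `y` would bump
a letter at most `y`, and this after `z > y` was bumped, which contradicts monotonicity. -/
theorem forall_lt_of_exists_lt (hw : (u ++ y :: v).Nodup)
    (hb : (bumped [] (u ++ y :: v)).Pairwise (· < ·))
    (h : ∃ z ∈ bumped [] u ++ (rowInsert y (rowAfter [] u)).2.toList, y < z) :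
    ∀ x ∈ v, y < x := by
  intro x hx
  have hy := not_mem_bumped_of_exists_lt hw hb h
  obtain ⟨z, hz, hyz⟩ := h
  rw [bumped_nil_append_cons] at hb hy
  obtain ⟨v1, v2, rfl⟩ := List.append_of_mem hx
  have hnd : ((u ++ y :: v1) ++ (x :: v2)).Nodup := by simpa using hw
  have hxy : x ≠ y := by
    rintro rfl
    exact (List.disjoint_of_nodup_append hnd) (a := x) (by simp) (by simp)
  by_contra hlt
  set r := (rowInsert y (rowAfter [] u)).1 with hr
  have hrow : rowAfter [] (u ++ y :: v1) = rowAfter r v1 := by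
    rw [rowAfter_append, rowAfter]
  have hyr : y ∈ r := by
    have := (rowInsert_perm y (rowAfter [] u)).mem_iff (a := y)
    simp only [List.mem_append, List.mem_cons, true_or, iff_true, Option.mem_toList] at this hy
    tauto
  have hmem : y ∈ rowAfter r v1 := by
    rcases mem_rowAfter_or_bumped.2 (Or.inl hyr : y ∈ r ∨ y ∈ v1) with h | h
    · exact h
    · refine absurd ?_ hy
      rw [bumped_append]
      simp [h]
  have hpw := pairwise_rowAfter List.Pairwise.nil (w := u ++ y :: v1)
    (List.Nodup.of_append_left hnd)
  rw [hrow] at hpw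
  obtain ⟨b, hb', hby⟩ := exists_rowInsert_eq_some hpw hmem (show x < y by omega)
  have hbmem : b ∈ bumped r (v1 ++ x :: v2) := by
    rw [bumped_append, bumped_cons]
    simp [hb']
  have := (List.pairwise_append.1 hb).2.2 z hz b hbmem
  omega

theorem not_mem_bumped_of_mem_map_fst (hw : w.Nodup) (hb : (bumped [] w).Pairwise (· < ·))
    (hy : y ∈ (bumps [] w).map Prod.fst) : y ∉ bumped [] w := by
  obtain ⟨u, v, rfl⟩ := List.append_of_mem ((map_fst_bumps_sublist _ _).subset hy)
  apply not_mem_bumped_of_exists_lt hw hb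
  have hnd := hw
  rw [List.nodup_append] at hnd
  rw [bumps_append, bumps, List.map_append, List.map_append, List.mem_append, List.mem_append] at hy
  rcases hy with hy | hy | hy
  · exact absurd rfl (hnd.2.2 y ((map_fst_bumps_sublist _ _).subset hy) y (by simp))
  · rcases ho : (rowInsert y (rowAfter [] u)).2 with _ | b
    · simp [ho] at hy
    · exact ⟨b, by simp, lt_of_rowInsert_eq_some ho⟩
  · exact absurd ((map_fst_bumps_sublist _ _).subset hy) (List.nodup_cons.1 hnd.2.1).1

/-- A greater letter before `y` would force all letters after `y` to be greater, and by the
equivalence all letters before it to be smaller. So both sides hold: `y` finds nothing to bump, and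
nothing after it can bump it. -/
theorem not_mem_bumps_of_iff (hw : (u ++ y :: v).Nodup)
    (hb : (bumped [] (u ++ y :: v)).Pairwise (· < ·))
    (h : (∀ z ∈ v, y < z) ↔ ∀ x ∈ u, x < y) :
    y ∉ (bumps [] (u ++ y :: v)).map Prod.fst ∧ y ∉ bumped [] (u ++ y :: v) := by
  have hnd := hw
  rw [List.nodup_append] at hnd
  have hu : ∀ x ∈ u, x < y := by
    by_contra hex
    have hex' := hex
    push Not at hex
    obtain ⟨x, hx, hyx⟩ := hex
    have hne := hnd.2.2 x hx y (by simp)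
    exact hex' (h.1 (forall_lt_of_exists_lt hw hb
      (exists_mem_bumped_step hnd.1 hx (by omega))))
  have hstep : ¬ ∃ z ∈ bumped [] u ++ (rowInsert y (rowAfter [] u)).2.toList, y < z := by
    rintro ⟨z, hz, hyz⟩
    have := hu z (mem_of_mem_bumped_step hz)
    omega
  constructor
  · rw [bumps_append, bumps, List.map_append, List.map_append, List.mem_append, List.mem_append]
    rintro (hy | hy | hy)
    · exact hnd.2.2 y ((map_fst_bumps_sublist _ _).subset hy) y (by simp) rfl
    · rcases ho : (rowInsert y (rowAfter [] u)).2 with _ | b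
      · simp [ho] at hy
      · exact hstep ⟨b, by simp [ho], lt_of_rowInsert_eq_some ho⟩
    · exact (List.nodup_cons.1 hnd.2.1).1 ((map_fst_bumps_sublist _ _).subset hy)
  · rw [bumped_nil_append_cons, List.mem_append]
    rintro (hy | hy)
    · have := hu y (mem_of_mem_bumped_step hy)
      omega
    · obtain ⟨a, ha, hay⟩ := exists_lt_of_mem_bumped hy
      have := h.2 hu a ha
      omega

/-- If the letters displaced from the first row are increasing, then the letters `y`
with all greater letters to the right and all smaller ones to the left neither displace nor are
displaced. -/
theorem two_mul_length_bumped_add_le {f : List ℕ} (hw : w.Nodup)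
    (hb : (bumped [] w).Pairwise (· < ·)) (hf : f.Nodup) (hfw : ∀ y ∈ f, y ∈ w)
    (h : ∀ y ∈ f, ∀ u v, w = u ++ y :: v → ((∀ z ∈ v, y < z) ↔ ∀ x ∈ u, x < y)) :
    2 * (bumped [] w).length + f.length ≤ w.length := by
  have hf' : ∀ y ∈ f, y ∉ (bumps [] w).map Prod.fst ∧ y ∉ bumped [] w := by
    intro y hy
    obtain ⟨u, v, rfl⟩ := List.append_of_mem (hfw y hy)
    exact not_mem_bumps_of_iff hw hb (h y hy u v rfl)
  have hsub : ∀ x ∈ bumped [] w, x ∈ w := by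
    intro x hx
    simpa using mem_rowAfter_or_bumped.1 (Or.inr hx : x ∈ rowAfter [] w ∨ x ∈ bumped [] w)
  -- Bumping letters, bumped letters and `f` are disjoint sets of letters of `w`, the first two
  -- equal in size.
  have hnd : ((bumps [] w).map Prod.fst ++ (bumped [] w ++ f)).Nodup := by
    rw [List.nodup_append, List.nodup_append]
    refine ⟨hw.sublist (map_fst_bumps_sublist _ _), ⟨hb.imp fun h => h.ne, hf, ?_⟩, ?_⟩
    · rintro x hx y hy rfl
      exact (hf' x hy).2 hx
    · rintro x hx y hy rfl
      rcases List.mem_append.1 hy with hy | hy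
      · exact not_mem_bumped_of_mem_map_fst hw hb hx hy
      · exact (hf' x hy).1 hx
  have hle := (List.subperm_of_subset hnd (l₂ := w) (by
    intro x hx
    rcases List.mem_append.1 hx with hx | hx
    · exact (map_fst_bumps_sublist _ _).subset hx
    · rcases List.mem_append.1 hx with hx | hx
      · exact hsub x hx
      · exact hfw x hx)).length_le
  simp only [List.length_append, List.length_map, bumped] at hle ⊢
  omega

end bumped

/-! ### The first row and increasing subsequences -/

theorem rowInsert_cases (a : ℕ) (r : List ℕ) :
    (rowInsert a r).1 = r ++ [a] ∧ (∀ x ∈ r, x ≤ a) ∨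
      ∃ p b q, r = p ++ b :: q ∧ (rowInsert a r).1 = p ++ a :: q ∧ ∀ x ∈ p, x ≤ a := by
  induction r with
  | nil => simp [rowInsert]
  | cons u r ih =>
    by_cases hau : a < u
    · right
      exact ⟨[], u, r, rfl, by simp [rowInsert, hau], by simp⟩
    · rcases ih with ⟨h1, h2⟩ | ⟨p, b, q, rfl, h1, h2⟩
      · left
        simp [rowInsert, hau, h1]
        exact ⟨by omega, h2⟩
      · right
        refine ⟨u :: p, b, q, rfl, by simp [rowInsert, hau, h1], ?_⟩
        intro x hx
        rcases List.mem_cons.1 hx with rfl | hx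
        · omega
        · exact h2 x hx

/-- Schensted's argument: when a letter enters the row at index `i`, its left neighbour is smaller
and already ends an increasing subsequence of length `i`. -/
theorem exists_sublist_of_getElem?_rowAfter {w : List ℕ} (hw : w.Nodup) {i x : ℕ}
    (h : (rowAfter [] w)[i]? = some x) :
    ∃ s, (s ++ [x]).Sublist w ∧ (s ++ [x]).Pairwise (· < ·) ∧ s.length = i := by
  induction w using List.reverseRecOn generalizing i x with
  | nil => simp [rowAfter] at h
  | append_singleton w a ih =>
    have hnd := List.nodup_append.1 hw
    have ih := @ih hnd.1
    have key : ∀ p q : List ℕ, rowAfter [] w = p ++ q → (∀ x ∈ p, x ≤ a) →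
        ∃ s, (s ++ [a]).Sublist (w ++ [a]) ∧ (s ++ [a]).Pairwise (· < ·) ∧
          s.length = p.length := by
      intro p q hpq hp
      rcases List.eq_nil_or_concat p with rfl | ⟨p', z, rfl⟩
      · exact ⟨[], by simp, by simp, rfl⟩
      · rw [List.concat_eq_append] at hpq hp ⊢
        obtain ⟨s, hs1, hs2, hs3⟩ := @ih p'.length z (by rw [hpq]; simp)
        refine ⟨s ++ [z], hs1.append (List.Sublist.refl _), ?_, by simp [hs3]⟩
        have hza : z < a := by
          have h1 := hp z (by simp)
          have h2 := hnd.2.2 z (hs1.subset (by simp)) a (by simp)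
          omega
        rw [List.pairwise_append]
        refine ⟨hs2, by simp, ?_⟩
        intro x hx y hy
        rw [List.mem_singleton.1 hy]
        rcases List.mem_append.1 hx with hx | hx
        · exact ((List.pairwise_append.1 hs2).2.2 x hx z (by simp)).trans hza
        · rwa [List.mem_singleton.1 hx]
    have old : (rowAfter [] w)[i]? = some x → ∃ s, (s ++ [x]).Sublist (w ++ [a]) ∧
        (s ++ [x]).Pairwise (· < ·) ∧ s.length = i := by
      intro h
      obtain ⟨s, hs1, hs2⟩ := ih h
      exact ⟨s, hs1.trans (List.sublist_append_left _ _), hs2⟩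
    rw [rowAfter_append, rowAfter, rowAfter] at h
    rcases rowInsert_cases a (rowAfter [] w) with ⟨h1, h2⟩ | ⟨p, b, q, h0, h1, h2⟩
    · rw [h1] at h
      rcases lt_or_ge i (rowAfter [] w).length with hi | hi
      · rw [List.getElem?_append_left hi] at h
        exact old h
      · rw [List.getElem?_append_right hi, List.getElem?_singleton] at h
        split_ifs at h with hi'
        obtain rfl : a = x := by simpa using h
        obtain ⟨s, hs1, hs2, hs3⟩ := key _ [] (by simp) h2
        exact ⟨s, hs1, hs2, by omega⟩
    · rw [h1] at h
      rcases lt_trichotomy i p.length with hi | rfl | hi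
      · rw [List.getElem?_append_left hi] at h
        apply old
        rw [h0, List.getElem?_append_left hi, h]
      · obtain rfl : a = x := by simpa using h
        exact key p (b :: q) h0 h2
      · apply old
        rw [List.getElem?_append_right (by omega), List.getElem?_cons, if_neg (by omega)] at h
        rw [h0, List.getElem?_append_right (by omega), List.getElem?_cons, if_neg (by omega), h]

/-- The first row is no longer than the longest increasing subsequence. -/
theorem exists_sublist_length_rowAfter {w : List ℕ} (hw : w.Nodup) :
    ∃ s : List ℕ, s.Sublist w ∧ s.Pairwise (· < ·) ∧ s.length = (rowAfter [] w).length := by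
  rcases Nat.eq_zero_or_pos (rowAfter [] w).length with h | h
  · exact ⟨[], by simp, by simp, by simp [h]⟩
  · obtain ⟨s, h1, h2, h3⟩ := exists_sublist_of_getElem?_rowAfter hw
      (List.getElem?_eq_getElem (show (rowAfter [] w).length - 1 < _ by omega))
    exact ⟨_, h1, h2, by simp; omega⟩

/-! ### Permutations with a two-row tableau -/

theorem length_oneLine {n : ℕ} (σ : Equiv.Perm (Fin n)) : (oneLine σ).length = n := by
  simp [oneLine]

theorem nodup_oneLine {n : ℕ} (σ : Equiv.Perm (Fin n)) : (oneLine σ).Nodup := by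
  rw [oneLine, List.nodup_ofFn]
  intro i j hij
  exact σ.injective (Fin.ext (by simpa using hij))

/-- In a permutation with a two-row insertion tableau, the second row has length
`(bumped [] w).length` where `w` is the one-line notation, and these letters are increasing. -/
theorem of_rskShape_eq_pair {n a b : ℕ} (hn : 0 < n) {σ : Equiv.Perm (Fin n)}
    (h : rskShape σ = {a, b}) :
    (bumped [] (oneLine σ)).Pairwise (· < ·) ∧
      (((rowAfter [] (oneLine σ)).length = a ∧ (bumped [] (oneLine σ)).length = b) ∨
        ((rowAfter [] (oneLine σ)).length = b ∧ (bumped [] (oneLine σ)).length = a)) := by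
  have hne : oneLine σ ≠ [] := by
    rw [Ne, ← List.length_eq_zero_iff, length_oneLine]
    omega
  rw [rskShape, insertionTableau_eq_cons hne, tableauShape] at h
  set w := oneLine σ with hw
  have hbw : (bumped [] w).Nodup := by
    have h1 := (rowAfter_perm [] w).nodup_iff.2 (nodup_oneLine σ)
    exact (List.nodup_append.1 h1).2.1
  have hcard := congrArg Multiset.card h
  have hb0 : bumped [] w ≠ [] := by
    intro hb0
    simp [hb0, insertionTableau] at hcard
  rw [insertionTableau_eq_cons hb0] at h hcard
  have hbb : bumped [] (bumped [] w) = [] := by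
    by_contra hbb
    rw [insertionTableau_eq_cons hbb] at hcard
    simp at hcard
  have hlen := length_rowAfter_add (bumped [] w)
  rw [hbb] at h hlen
  refine ⟨pairwise_append_of_bumped_eq_nil (r := []) List.Pairwise.nil hbw hbb, ?_⟩
  rw [List.length_nil, add_zero] at hlen
  rw [List.map_cons, List.map_cons, hlen] at h
  simp only [insertionTableau, List.foldl_nil, List.map_nil] at h
  have h2 : ([(rowAfter [] w).length, (bumped [] w).length] : List ℕ).Perm [a, b] :=
    Multiset.coe_eq_coe.1 h
  simpa using List.perm_pair.1 h2

/-- If `σ` maps the points on one side of `i` into that side, it does so bijectively by finiteness,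
and the other side is then preserved too. -/
theorem forall_lt_iff_forall_gt {n : ℕ} {σ : Equiv.Perm (Fin n)} {i : Fin n} (hi : σ i = i) :
    (∀ j, i < j → i < σ j) ↔ ∀ j, j < i → σ j < i := by
  constructor
  · intro h j hj
    have hsub : (Finset.Ioi i).map σ.toEmbedding ⊆ Finset.Ioi i := by
      intro x hx
      obtain ⟨y, hy, rfl⟩ := Finset.mem_map.1 hx
      exact Finset.mem_Ioi.2 (h y (Finset.mem_Ioi.1 hy))
    have heq := Finset.eq_of_subset_of_card_le hsub (by rw [Finset.card_map])
    refine lt_of_le_of_ne (not_lt.1 fun hlt => ?_) fun hji => hj.ne (σ.injective (hji.trans hi.symm))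
    rw [← Finset.mem_Ioi, ← heq] at hlt
    obtain ⟨y, hy, hyj⟩ := Finset.mem_map.1 hlt
    have hyj' : y = j := σ.injective hyj
    exact absurd (Finset.mem_Ioi.1 (hyj' ▸ hy)) hj.not_gt
  · intro h j hj
    have hsub : (Finset.Iio i).map σ.toEmbedding ⊆ Finset.Iio i := by
      intro x hx
      obtain ⟨y, hy, rfl⟩ := Finset.mem_map.1 hx
      exact Finset.mem_Iio.2 (h y (Finset.mem_Iio.1 hy))
    have heq := Finset.eq_of_subset_of_card_le hsub (by rw [Finset.card_map])
    refine lt_of_le_of_ne (not_lt.1 fun hlt => ?_) fun hji => hj.ne (σ.injective (hi.trans hji))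
    rw [← Finset.mem_Iio, ← heq] at hlt
    obtain ⟨y, hy, hyj⟩ := Finset.mem_map.1 hlt
    have hyj' : y = j := σ.injective hyj
    exact absurd (Finset.mem_Iio.1 (hyj' ▸ hy)) hj.not_gt

theorem two_mul_length_bumped_add_card_le {n : ℕ} {σ : Equiv.Perm (Fin n)}
    (hb : (bumped [] (oneLine σ)).Pairwise (· < ·)) :
    2 * (bumped [] (oneLine σ)).length + (n - σ.support.card) ≤ n := by
  set f : List ℕ := (σ.supportᶜ).toList.map fun i : Fin n => (i : ℕ) + 1 with hf
  have hlen : f.length = n - σ.support.card := by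
    rw [hf, List.length_map, Finset.length_toList, Finset.card_compl, Fintype.card_fin]
  have hmem : ∀ y ∈ f, ∃ i : Fin n, σ i = i ∧ y = (i : ℕ) + 1 := by
    intro y hy
    obtain ⟨i, hi, rfl⟩ := List.mem_map.1 hy
    exact ⟨i, by simpa using hi, rfl⟩
  rw [← hlen]
  refine (two_mul_length_bumped_add_le (nodup_oneLine σ) hb ?_ ?_ ?_).trans_eq (length_oneLine σ)
  · rw [hf]
    refine (Finset.nodup_toList _).map fun i j hij => Fin.ext ?_
    simpa using hij
  · intro y hy
    obtain ⟨i, hi, rfl⟩ := hmem y hy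
    rw [oneLine, List.mem_ofFn]
    exact ⟨i, by rw [hi]⟩
  · intro y hy u v huv
    obtain ⟨i, hi, rfl⟩ := hmem y hy
    have hget : ∀ j : Fin n, (oneLine σ)[(j : ℕ)]? = some ((σ j : ℕ) + 1) := by
      intro j
      simp [oneLine]
    have hlenw : u.length + (v.length + 1) = n := by
      have := congrArg List.length huv
      simpa [length_oneLine] using this.symm
    -- The letter `i + 1` occurs only at position `i`, because `i` is fixed.
    have hu : u.length = i := by
      have h1 := hget ⟨u.length, by omega⟩
      rw [huv] at h1
      simp only [le_refl, List.getElem?_append_right, tsub_self, List.getElem?_cons_zero,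
        Option.some.injEq, add_left_inj] at h1
      have h2 : i = σ ⟨u.length, by omega⟩ := Fin.ext h1
      rw [← hi] at h2
      exact (congrArg Fin.val (σ.injective h2)).symm
    have hv1 : (∀ z ∈ v, (i : ℕ) + 1 < z) ↔ ∀ j, i < j → i < σ j := by
      constructor
      · intro h j hj
        have h1 := hget j
        rw [huv, List.getElem?_append_right (by omega), List.getElem?_cons,
          if_neg (by omega)] at h1
        have := h _ (List.mem_of_getElem? h1)
        omega
      · intro h z hz
        obtain ⟨k, hk, rfl⟩ := List.mem_iff_getElem.1 hz
        have h1 := hget ⟨u.length + 1 + k, by omega⟩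
        rw [huv, List.getElem?_append_right (by simp; omega), List.getElem?_cons,
          if_neg (by simp; omega)] at h1
        simp only [show u.length + 1 + k - u.length - 1 = k by omega,
          List.getElem?_eq_getElem hk, Option.some.injEq] at h1
        have := h ⟨u.length + 1 + k, by omega⟩ (by rw [Fin.lt_def]; simp; omega)
        omega
    have hu1 : (∀ z ∈ u, z < (i : ℕ) + 1) ↔ ∀ j, j < i → σ j < i := by
      constructor
      · intro h j hj
        have h1 := hget j
        rw [huv, List.getElem?_append_left (by omega)] at h1
        have := h _ (List.mem_of_getElem? h1)
        omega
      · intro h z hz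
        obtain ⟨k, hk, rfl⟩ := List.mem_iff_getElem.1 hz
        have h1 := hget ⟨k, by omega⟩
        rw [huv, List.getElem?_append_left hk, List.getElem?_eq_getElem hk,
          Option.some.injEq] at h1
        have := h ⟨k, by omega⟩ (by rw [Fin.lt_def]; simp; omega)
        omega
    rw [hv1, hu1]
    exact forall_lt_iff_forall_gt hi

theorem exists_eq_succAbove_of_strictMono {m : ℕ} {f : Fin m → Fin (m + 1)} (hf : StrictMono f) :
    ∃ p : Fin (m + 1), f = p.succAbove := by
  have hnot : ¬ Function.Surjective f := by
    intro h
    have := Fintype.card_le_of_surjective f h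
    simp at this
  rw [Function.Surjective] at hnot
  push Not at hnot
  obtain ⟨p, hp⟩ := hnot
  refine ⟨p, (StrictMono.range_inj hf (Fin.strictMono_succAbove p)).1 ?_⟩
  rw [Fin.range_succAbove]
  have hsub : Finset.univ.image f ⊆ {p}ᶜ := by
    intro x hx
    obtain ⟨y, -, rfl⟩ := Finset.mem_image.1 hx
    simpa using hp y
  have heq := Finset.eq_of_subset_of_card_le hsub (by
    rw [Finset.card_image_of_injective _ hf.injective, Finset.card_compl]
    simp)
  have := congrArg (fun s : Finset (Fin (m + 1)) => (s : Set (Fin (m + 1)))) heq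
  simpa using this

/-- Away from `p` the permutation is the increasing bijection onto the complement of `q`, so it must
send `p` to `q`. -/
theorem eq_cycleIcc_of_comp_succAbove {m : ℕ} {σ : Equiv.Perm (Fin (m + 1))} {p q : Fin (m + 1)}
    (h : σ ∘ p.succAbove = q.succAbove) (hqp : q ≤ p) : σ = Fin.cycleIcc q p := by
  ext x : 1
  rcases eq_or_ne x p with rfl | hx
  · rw [Fin.cycleIcc_of_last hqp]
    by_contra hne
    obtain ⟨y, hy⟩ := Fin.exists_succAbove_eq hne
    rw [← h] at hy
    exact Fin.succAbove_ne _ _ (σ.injective hy)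
  · obtain ⟨y, rfl⟩ := Fin.exists_succAbove_eq hx
    exact congrFun (h.trans (Fin.cycleIcc_comp_succAbove q p hqp).symm) y

/-- A permutation other than the identity that is increasing outside one point is a cycle. -/
theorem isCycle_of_sublist {n : ℕ} {σ : Equiv.Perm (Fin n)} {s : List ℕ}
    (hs : s.Sublist (oneLine σ)) (hpw : s.Pairwise (· < ·)) (hlen : s.length + 1 = n)
    (hσ : σ ≠ 1) : σ.IsCycle := by
  subst hlen
  obtain ⟨f, hf⟩ := List.sublist_iff_exists_fin_orderEmbedding_get_eq.1 hs
  let g : Fin s.length → Fin (s.length + 1) := fun i => Fin.cast (length_oneLine σ) (f i)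
  have hg : StrictMono g := fun i j hij => by
    have := f.strictMono hij
    simpa [g] using this
  have hσg : StrictMono (σ ∘ g) := by
    intro i j hij
    have h1 := List.pairwise_iff_get.1 hpw i j hij
    rw [hf, hf] at h1
    simp only [oneLine, List.get_eq_getElem, List.getElem_ofFn, add_lt_add_iff_right] at h1
    exact h1
  obtain ⟨p, hp⟩ := exists_eq_succAbove_of_strictMono hg
  obtain ⟨q, hq⟩ := exists_eq_succAbove_of_strictMono hσg
  rw [hp] at hq
  rcases lt_trichotomy q p with h | rfl | h
  · rw [eq_cycleIcc_of_comp_succAbove hq h.le]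
    exact Fin.isCycle_cycleIcc h
  · refine absurd ?_ hσ
    rw [eq_cycleIcc_of_comp_succAbove hq le_rfl, Fin.cycleIcc_eq]
  · have hinv : ⇑σ⁻¹ ∘ q.succAbove = p.succAbove := by
      rw [← hq]
      ext x
      simp
    have := eq_cycleIcc_of_comp_succAbove hinv h.le
    rw [← Equiv.Perm.isCycle_inv, this]
    exact Fin.isCycle_cycleIcc h

theorem isCycle_of_rskShape_eq {n : ℕ} (hn : 3 ≤ n) {σ : Equiv.Perm (Fin n)}
    (h : rskShape σ = {n - 1, 1}) : σ.IsCycle := by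
  obtain ⟨hpw, hlen⟩ := of_rskShape_eq_pair (by omega) h
  have hle := two_mul_length_bumped_add_card_le hpw
  obtain ⟨s, hs, hspw, hslen⟩ := exists_sublist_length_rowAfter (nodup_oneLine σ)
  -- The first row has length `n - 1` and not 1, since twice the number of bumped letters is at most
  -- `n` and `n ≥ 3`.
  apply isCycle_of_sublist hs hspw (by omega)
  rintro rfl
  rw [Equiv.Perm.support_one, Finset.card_empty] at hle
  omega

theorem card_compl_support_le {n : ℕ} (hn : 0 < n) {σ : Equiv.Perm (Fin n)}
    (h : rskShape σ = {(n + 1) / 2, n / 2}) : n - σ.support.card ≤ n % 2 := by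
  obtain ⟨hpw, hlen⟩ := of_rskShape_eq_pair hn h
  have hle := two_mul_length_bumped_add_card_le hpw
  omega

/-! ### Complete cycle decompositions -/

theorem count_one_partition {n : ℕ} (σ : Equiv.Perm (Fin n)) :
    σ.partition.parts.count 1 = n - σ.support.card := by
  have h1 : σ.cycleType.count 1 = 0 := by
    rw [Multiset.count_eq_zero]
    intro h
    have := Equiv.Perm.two_le_of_mem_cycleType h
    omega
  rw [Equiv.Perm.parts_partition, Multiset.count_add, h1, Multiset.count_replicate_self,
    Fintype.card_fin, zero_add]

theorem IsRSKCompleteCycleDecomposition.exists_pair {n : ℕ} {c : n.Partition}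
    (h : IsRSKCompleteCycleDecomposition c) {a b : ℕ} (ha : 2 ≤ a) (hb : 0 < b) (hab : a + b = n) :
    ∃ σ : Equiv.Perm (Fin n), σ.partition.parts = c.parts ∧ rskShape σ = {a, b} := by
  let μ : n.Partition :=
    { parts := {a, b}
      parts_pos := by
        intro i hi
        rcases (by simpa using hi : i = a ∨ i = b) with rfl | rfl <;> omega
      parts_sum := by simpa using hab }
  refine h μ (fun heq => ?_) fun heq => ?_
  · have := congrArg Multiset.card heq
    simp [μ] at this
  · have hmem : a ∈ Multiset.replicate n 1 := by
      rw [← heq]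
      simp [μ]
    have := Multiset.eq_of_mem_replicate hmem
    omega

/-- The number of fixed points depends only on the cycle type. The bound from the balanced two-row
shape therefore also applies to the cycle of shape (n-1, 1). -/
theorem parts_eq_of_isRSKComplete {n : ℕ} (hn : 3 ≤ n) {c : n.Partition}
    (h : IsRSKCompleteCycleDecomposition c) :
    c.parts = {n} ∨ (Odd n ∧ c.parts = {n - 1, 1}) := by
  obtain ⟨σ, hσ, hσs⟩ := h.exists_pair (a := n - 1) (b := 1) (by omega) one_pos (by omega)
  obtain ⟨τ, hτ, hτs⟩ := h.exists_pair (a := (n + 1) / 2) (b := n / 2) (by omega) (by omega)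
    (by omega)
  have hcount : n - σ.support.card ≤ n % 2 := by
    rw [← count_one_partition, hσ, ← hτ, count_one_partition]
    exact card_compl_support_le (by omega) hτs
  have hle : σ.support.card ≤ n := by
    simpa using Finset.card_le_univ σ.support
  rw [← hσ, partition_parts_of_isCycle (isCycle_of_rskShape_eq hn hσs)]
  rcases Nat.eq_zero_or_pos (n - σ.support.card) with h0 | h0
  · left
    rw [h0, show σ.support.card = n by omega]
    simp
  · right
    refine ⟨Nat.odd_iff.2 (by omega), ?_⟩
    rw [show n - σ.support.card = 1 by omega, show σ.support.card = n - 1 by omega]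
    rfl

theorem parts_eq_singleton_one (c : Nat.Partition 1) : c.parts = {1} := by
  rw [Subsingleton.elim c (Nat.Partition.indiscrete 1), Nat.Partition.indiscrete_parts one_ne_zero]

theorem mainTheorem1 (n : ℕ) (hn : 0 < n) (hn2 : n ≠ 2) :
    (Even n → ∀ c : n.Partition,
      IsRSKCompleteCycleDecomposition c ↔ c.parts = {n}) ∧
    (Odd n → ∀ c : n.Partition,
      IsRSKCompleteCycleDecomposition c ↔ c.parts = {n} ∨ c.parts = {n - 1, 1}) := by
  have key : ∀ c : n.Partition, IsRSKCompleteCycleDecomposition c →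
      c.parts = {n} ∨ (Odd n ∧ c.parts = {n - 1, 1}) := by
    intro c hc
    rcases Nat.lt_or_ge n 3 with h | h
    · obtain rfl : n = 1 := by omega
      exact Or.inl (parts_eq_singleton_one c)
    · exact parts_eq_of_isRSKComplete h hc
  refine ⟨fun heven c => ⟨fun hc => ?_, isRSKComplete_of_parts_eq hn⟩, fun hodd c =>
    ⟨fun hc => (key c hc).imp_right And.right, ?_⟩⟩
  · exact (key c hc).resolve_right fun h => Nat.not_even_iff_odd.2 h.1 heven
  · rintro (hc | hc)
    · exact isRSKComplete_of_parts_eq hn hc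
    · exact isRSKComplete_of_parts_eq_of_odd hn hodd hc
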